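/- For a finite presentation $\langle X\mid R\rangle$ of a group $G$ and a word $w$ in $X\sqcup X^{-1}$ representing $1\in G$, let $\mathrm{Area}(w)$ be the least $l$ such that $w=\prod_{i=1}^{l}w_ir_iw_i^{-1}$ in the free group $F(X)$ with $w_i\in F(X)$ and $r_i\in R^{\pm1}$. The Dehn function of the presentation is $\delta(n)=\max\{\mathrm{Area}(w) : w=1 \text{ in } G,\ |w|\le n\}$. For functions $f,g:\mathbb N\to\mathbb R$ write $f\preccurlyeq g$ if there is an integer $C>0$ with $f(n)\le C\,g(Cn+C)+Cn+C$ for all $n$. The superadditive closure $\overline f$ of $f$ is the smallest function with $\overline f\ge f$ and $\overline f(n+m)\ge\overline f(n)+\overline f(m)$ for all $n,m>0$. **Theorem.** Let $G_1,G_2,G_3$ be finitely presented groups, let $\phi: G_1\times G_2\times G_3\to\mathbb Z$ be a homomorphism whose restriction to each factor $G_i$ is surjective, and let $K=\ker\phi$. Then $K$ is finitely presented. Moreover, if $f$ is the Dehn function of $G_1\times G_2\times G_3$ with respect to any finite presentation, and $\delta_K$ is the Dehn function of $K$ with respect to any finite presentation, then $$f(n)\preccurlyeq\delta_K(n)\preccurlyeq\overline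 f(n)\cdot\log(n).$$ -/

import Mathlib

/-- A finite presentation `⟨X ∣ R⟩` of the group `G`: a finite set `X` of generators, a finite set
`R` of elements of the free group `F(X)`, and an epimorphism `F(X) → G` whose kernel is the normal
closure of `R`. -/
structure FinitePresentation (X : Type*) (G : Type*) [Group G] where
  finite_gens : Finite X
  rels : Set (FreeGroup X)
  finite_rels : rels.Finite
  hom : FreeGroup X →* G
  hom_surjective : Function.Surjective hom
  ker_hom : hom.ker = Subgroup.normalClosure rels

namespace FinitePresentation

variable {X : Type*} {G : Type*} [Group G] (P : FinitePresentation X G)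

/-- `w` is, in the free group, a product of `l` conjugates of relators and their inverses. -/
def HasFilling (w : FreeGroup X) (l : ℕ) : Prop :=
  ∃ L : List (FreeGroup X × FreeGroup X), L.length = l ∧
    (∀ p ∈ L, p.2 ∈ P.rels ∨ p.2⁻¹ ∈ P.rels) ∧
    w = (L.map fun p => p.1 * p.2 * p.1⁻¹).prod

/-- The area of a null-homotopic word: the minimal number of conjugates of relators and their
inverses whose product is `w` in the free group. -/
noncomputable def area (w : FreeGroup X) : ℕ :=
  sInf {l | P.HasFilling w l}

/-- The areas of the null-homotopic words of length at most `n`. Words are elements of the free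
monoid on `X ⊔ X⁻¹` (not necessarily reduced), that is, lists over `X × Bool`. -/
def areas (n : ℕ) : Set ℕ :=
  {a | ∃ w : List (X × Bool), w.length ≤ n ∧ P.hom (FreeGroup.mk w) = 1 ∧
    a = P.area (FreeGroup.mk w)}

/-- The Dehn function of a finite presentation: the maximal area of a null-homotopic word of
length at most `n`. -/
noncomputable def dehn (n : ℕ) : ℕ :=
  sSup (P.areas n)

/-- The area of a null-homotopic word is attained. -/
theorem hasFilling_area {w : FreeGroup X} (hw : P.hom w = 1) : P.HasFilling w (P.area w) := by
  refine Nat.sInf_mem (s := {l | P.HasFilling w l}) ?_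
  have h : w ∈ Subgroup.normalClosure P.rels := by
    rw [← P.ker_hom]; exact hw
  refine Subgroup.closure_induction (p := fun w _ => ∃ l, P.HasFilling w l) ?_ ?_ ?_ ?_ h
  · intro x hx
    obtain ⟨r, hr, hc⟩ := Group.mem_conjugatesOfSet_iff.1 hx
    obtain ⟨c, hc⟩ := isConj_iff.1 hc
    exact ⟨1, [(c, r)], rfl, by simp [hr], by simp [hc]⟩
  · exact ⟨0, [], rfl, by simp, by simp⟩
  · rintro x y - - ⟨l, L, hL, h1, h2⟩ ⟨m, M, hM, h3, h4⟩
    refine ⟨l + m, L ++ M, by simp [hL, hM], ?_, by simp [h2, h4]⟩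
    intro p hp
    rcases List.mem_append.1 hp with hp | hp
    · exact h1 p hp
    · exact h3 p hp
  · rintro x - ⟨l, L, hL, h1, h2⟩
    refine ⟨l, (L.map fun p => (p.1, p.2⁻¹)).reverse, by simp [hL], ?_, ?_⟩
    · intro p hp
      simp only [List.mem_reverse, List.mem_map] at hp
      obtain ⟨q, hq, rfl⟩ := hp
      simpa using (h1 q hq).symm
    · rw [h2, List.prod_inv_reverse]
      simp [Function.comp_def, mul_assoc]

/-- The maximum defining the Dehn function is attained. -/
theorem isGreatest_dehn (n : ℕ) : IsGreatest (P.areas n) (P.dehn n) := by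
  have := P.finite_gens
  have hf : (P.areas n).Finite := by
    refine ((List.finite_length_le (X × Bool) n).image
      fun w => P.area (FreeGroup.mk w)).subset ?_
    rintro a ⟨w, hw, -, rfl⟩
    exact ⟨w, hw, rfl⟩
  have hne : (P.areas n).Nonempty := ⟨_, [], by simp, by simp [← FreeGroup.one_eq_mk], rfl⟩
  exact ⟨Nat.sSup_mem hne hf.bddAbove, fun a ha => le_csSup hf.bddAbove ha⟩

end FinitePresentation

/-- Superadditivity of a function of positive integers (the value at `0` is unconstrained). -/
def IsSuperadditive (g : ℕ → ℝ) : Prop :=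
  ∀ m n : ℕ, 0 < m → 0 < n → g m + g n ≤ g (m + n)

/-- The superadditive closure of `f`: the smallest superadditive function bounded below by `f`. -/
noncomputable def superadditiveClosure (f : ℕ → ℝ) (n : ℕ) : ℝ :=
  sInf {x | ∃ g : ℕ → ℝ, IsSuperadditive g ∧ (∀ k, f k ≤ g k) ∧ x = g n}

/-- Every function is dominated by a superadditive one. -/
theorem exists_isSuperadditive_ge (f : ℕ → ℝ) :
    ∃ g : ℕ → ℝ, IsSuperadditive g ∧ ∀ k, f k ≤ g k := by
  refine ⟨fun n => (if n = 0 then |f 0| else 0) + n * ∑ i ∈ Finset.range (n + 1), |f i|, ?_, ?_⟩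
  · intro m n hm0 hn0
    have hm : ∑ i ∈ Finset.range (m + 1), |f i| ≤ ∑ i ∈ Finset.range (m + n + 1), |f i| :=
      Finset.sum_le_sum_of_subset_of_nonneg (Finset.range_mono (by omega)) (by simp)
    have hn : ∑ i ∈ Finset.range (n + 1), |f i| ≤ ∑ i ∈ Finset.range (m + n + 1), |f i| :=
      Finset.sum_le_sum_of_subset_of_nonneg (Finset.range_mono (by omega)) (by simp)
    simp only [hm0.ne', hn0.ne', (Nat.add_pos_left hm0 n).ne', if_false, zero_add]
    push_cast
    nlinarith [mul_le_mul_of_nonneg_left hm (Nat.cast_nonneg (α := ℝ) m),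
      mul_le_mul_of_nonneg_left hn (Nat.cast_nonneg (α := ℝ) n)]
  · intro k
    rcases Nat.eq_zero_or_pos k with rfl | hk
    · simp [le_abs_self]
    · have h1 : |f k| ≤ ∑ i ∈ Finset.range (k + 1), |f i| :=
        Finset.single_le_sum (f := fun i => |f i|) (by simp) (by simp)
      have h2 : (1 : ℝ) ≤ k := by exact_mod_cast hk
      simp only [hk.ne', if_false, zero_add]
      nlinarith [le_abs_self (f k), abs_nonneg (f k)]

/-- The superadditive closure is indeed the least superadditive function bounded below by `f`. -/
theorem isLeast_superadditiveClosure (f : ℕ → ℝ) :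
    IsLeast {g : ℕ → ℝ | IsSuperadditive g ∧ ∀ k, f k ≤ g k} (superadditiveClosure f) := by
  have hne : ∀ n, {x | ∃ g : ℕ → ℝ, IsSuperadditive g ∧ (∀ k, f k ≤ g k) ∧ x = g n}.Nonempty := by
    intro n
    obtain ⟨g, h1, h2⟩ := exists_isSuperadditive_ge f
    exact ⟨g n, g, h1, h2, rfl⟩
  have hle : ∀ g : ℕ → ℝ, IsSuperadditive g → (∀ k, f k ≤ g k) →
      ∀ n, superadditiveClosure f n ≤ g n := by
    intro g h1 h2 n
    refine csInf_le ⟨f n, ?_⟩ ⟨g, h1, h2, rfl⟩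
    rintro x ⟨g', -, h, rfl⟩
    exact h n
  refine ⟨⟨fun m n hm hn => ?_, fun k => ?_⟩, fun g hg n => hle g hg.1 hg.2 n⟩
  · refine le_csInf (hne _) ?_
    rintro x ⟨g, h1, h2, rfl⟩
    exact (add_le_add (hle g h1 h2 m) (hle g h1 h2 n)).trans (h1 m n hm hn)
  · refine le_csInf (hne _) ?_
    rintro x ⟨g, -, h2, rfl⟩
    exact h2 k

/-- `f ≼ g`: there is a constant `C > 0` with `f n ≤ C * g (C * n + C) + C * n + C` for all `n`. -/
def AsympLE (f g : ℕ → ℝ) : Prop :=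
  ∃ C : ℕ, 0 < C ∧ ∀ n : ℕ, f n ≤ C * g (C * n + C) + C * n + C

/-! The argument shows more than the stated upper bound: `δ_K` and `f` bound each other up to
multiplicative constants in value and argument. Both are comparable to `n ^ 2` plus the Dehn
functions of the three factors.

Fix `tₖ` in the `k`-th factor with height (value of `φ`) equal to 1. For `j ≠ k`, the map `g ↦ g *
tₖ ^ (-φ g)` embeds `Gⱼ` in `K`; lift it to a homomorphism `iⱼₖ` of free groups. Two such maps from
different factors, correcting in the same factor, commute in `K`. Changing the correcting factor
multiplies by a power of a fixed element of `K` (a twist relation). A word `w` with coordinates `θ₁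
w`, `θ₂ w`, `θ₃ w` has the normal form `i₁₃ (θ₁ w) * i₂₃ (θ₂ w) * i₃₁ (t ^ height * θ₃ w)`, whose
last argument has height zero. On such arguments `i₃₁` and `i₃₂` nearly agree, so the last factor
can be moved past either of the others after choosing the suitable one: this is where three factors
are needed.

Hence two normal forms of length scale `n` multiply with quadratic area (`CoverData.nf_mul`).
Halving words gives `T(n) ≤ T(⌊n/2⌋) + T(⌈n/2⌉) + C * n ^ 2`, which is again quadratic
(`CoverData.closeIn_nf`). The Dehn functions of the factors enter only once, when the three factors
of the final normal form are filled (`KerHoms.exists_relators`), so no logarithm arises. These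
relators also present `K`.

The quadratic term is harmless because `K` and the product both retract onto `ℤ²`, which forces
quadratic area through the Heisenberg group (`FinitePresentation.sq_le_dehn`). Each `Gᵢ` is a
retract of `K` and of the product, so its Dehn function is dominated by both; conversely, splitting
a word of the product into coordinates costs quadratic area. -/

/-! ### Areas and approximate equality relative to a set of relators -/

/-- `w` is a product of at most `l` conjugates of elements of `S` and their inverses. -/
def FillsIn {F : Type*} [Group F] (S : Set F) (l : ℕ) (w : F) : Prop :=
  ∃ L : List (F × F), L.length ≤ l ∧ (∀ p ∈ L, p.2 ∈ S ∨ p.2⁻¹ ∈ S) ∧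
    w = (L.map fun p => p.1 * p.2 * p.1⁻¹).prod

/-- `u` can be transformed into `v` by at most `l` applications of relators from `S`. -/
def CloseIn {F : Type*} [Group F] (S : Set F) (l : ℕ) (u v : F) : Prop :=
  FillsIn S l (u * v⁻¹)

namespace FillsIn

variable {F F' : Type*} [Group F] [Group F'] {S : Set F} {k l : ℕ} {u v w : F}

theorem one : FillsIn S l 1 := ⟨[], by simp, by simp, by simp⟩

theorem mono (h : FillsIn S k w) (hkl : k ≤ l) : FillsIn S l w := by
  obtain ⟨L, h1, h2, h3⟩ := h
  exact ⟨L, h1.trans hkl, h2, h3⟩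

theorem mul (hu : FillsIn S k u) (hv : FillsIn S l v) : FillsIn S (k + l) (u * v) := by
  obtain ⟨L, h1, h2, h3⟩ := hu
  obtain ⟨M, h4, h5, h6⟩ := hv
  refine ⟨L ++ M, by simp; omega, ?_, by simp [h3, h6]⟩
  intro p hp
  rcases List.mem_append.1 hp with hp | hp
  · exact h2 p hp
  · exact h5 p hp

theorem inv (h : FillsIn S l w) : FillsIn S l w⁻¹ := by
  obtain ⟨L, h1, h2, h3⟩ := h
  refine ⟨(L.map fun p => (p.1, p.2⁻¹)).reverse, by simpa using h1, ?_, ?_⟩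
  · intro p hp
    simp only [List.mem_reverse, List.mem_map] at hp
    obtain ⟨q, hq, rfl⟩ := hp
    simpa using (h2 q hq).symm
  · rw [h3, List.prod_inv_reverse]
    simp [Function.comp_def, mul_assoc]

theorem of_mem (h : w ∈ S) : FillsIn S 1 w := ⟨[(1, w)], by simp, by simp [h], by simp⟩

theorem conj (g : F) (h : FillsIn S l w) : FillsIn S l (g * w * g⁻¹) := by
  obtain ⟨L, h1, h2, h3⟩ := h
  refine ⟨L.map fun p => (g * p.1, p.2), by simpa using h1, ?_, ?_⟩
  · intro p hp
    obtain ⟨q, hq, rfl⟩ := List.mem_map.1 hp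
    exact h2 q hq
  · have := map_list_prod (MulAut.conj g).toMonoidHom (L.map fun p => p.1 * p.2 * p.1⁻¹)
    simp only [MulEquiv.coe_toMonoidHom, MulAut.conj_apply, List.map_map] at this
    rw [h3, this]
    simp [Function.comp_def, mul_assoc]

theorem prod_map (f : F →* F') {T : Set F'} {c : ℕ}
    (hf : ∀ r ∈ S, FillsIn T c (f r)) :
    ∀ L : List (F × F), (∀ p ∈ L, p.2 ∈ S ∨ p.2⁻¹ ∈ S) →
      FillsIn T (c * L.length) (f (L.map fun p => p.1 * p.2 * p.1⁻¹).prod)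
  | [], _ => by simpa using one
  | p :: L, h => by
    have h1 : FillsIn T c (f p.2) := by
      rcases h p (by simp) with h | h
      · exact hf _ h
      · simpa using (hf _ h).inv
    have h2 := prod_map f hf L fun q hq => h q (by simp [hq])
    have h3 := (h1.conj (f p.1)).mul h2
    have h4 := h3.mono (l := c * (p :: L).length) (by simp [mul_add]; omega)
    simpa [mul_assoc] using h4

/-- A homomorphism that maps relators to elements of area at most `c` multiplies areas by at most
`c`. -/
theorem map (f : F →* F') {T : Set F'} {c : ℕ} (hf : ∀ r ∈ S, FillsIn T c (f r))
    (h : FillsIn S l w) : FillsIn T (c * l) (f w) := by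
  obtain ⟨L, h1, h2, rfl⟩ := h
  exact (prod_map f hf L h2).mono (Nat.mul_le_mul_left c h1)

theorem mem_normalClosure (h : FillsIn S l w) : w ∈ Subgroup.normalClosure S := by
  obtain ⟨L, -, h2, rfl⟩ := h
  refine Subgroup.list_prod_mem _ fun x hx => ?_
  obtain ⟨p, hp, rfl⟩ := List.mem_map.1 hx
  refine Subgroup.normalClosure_normal.conj_mem _ ?_ _
  rcases h2 p hp with h | h
  · exact Subgroup.subset_normalClosure h
  · exact inv_mem_iff.1 (Subgroup.subset_normalClosure h)

end FillsIn

namespace CloseIn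

variable {F : Type*} [Group F] {S : Set F} {k l : ℕ} {u v w u' v' : F}

theorem refl : CloseIn S l u u := by simpa [CloseIn] using FillsIn.one

theorem of_eq (h : u = v) : CloseIn S l u v := h ▸ refl

theorem mono (h : CloseIn S k u v) (hkl : k ≤ l) : CloseIn S l u v := FillsIn.mono h hkl

theorem symm (h : CloseIn S l u v) : CloseIn S l v u := by
  simpa [CloseIn] using FillsIn.inv h

theorem trans (h : CloseIn S k u v) (h' : CloseIn S l v w) : CloseIn S (k + l) u w := by
  simpa [CloseIn] using FillsIn.mul h h'

theorem mul_left (g : F) (h : CloseIn S l u v) : CloseIn S l (g * u) (g * v) := by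
  simpa [CloseIn, mul_assoc] using FillsIn.conj g h

theorem mul_right (g : F) (h : CloseIn S l u v) : CloseIn S l (u * g) (v * g) := by
  simpa [CloseIn, mul_assoc] using h

theorem mul (h : CloseIn S k u v) (h' : CloseIn S l u' v') :
    CloseIn S (k + l) (u * u') (v * v') :=
  (h.mul_right u').trans (h'.mul_left v)

theorem inv (h : CloseIn S l u v) : CloseIn S l u⁻¹ v⁻¹ := by
  simpa [CloseIn, mul_assoc] using (FillsIn.inv h).conj u⁻¹

theorem comm_inv (h : CloseIn S l (u * v) (v * u)) : CloseIn S l (u⁻¹ * v) (v * u⁻¹) := by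
  have := (h.symm.mul_left u⁻¹).mul_right u⁻¹
  simpa [mul_assoc] using this

theorem comm_pow (h : CloseIn S l (u * v) (v * u)) (n : ℕ) :
    CloseIn S (l * n) (u ^ n * v) (v * u ^ n) := by
  induction n with
  | zero => simpa using refl
  | succ n ih =>
    have h1 := (h.mul_left (u ^ n)).trans
      ((of_eq (l := 0) (by simp [mul_assoc])).trans (ih.mul_right u))
    have h2 : CloseIn S (l * (n + 1)) (u ^ n * (u * v)) (v * u ^ n * u) :=
      h1.mono (by rw [mul_add]; omega)
    simpa [pow_succ, mul_assoc] using h2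

theorem comm_zpow (h : CloseIn S l (u * v) (v * u)) (n : ℤ) :
    CloseIn S (l * n.natAbs) (u ^ n * v) (v * u ^ n) := by
  obtain ⟨m, rfl | rfl⟩ := n.eq_nat_or_neg
  · simpa using h.comm_pow m
  · simpa using (h.comm_pow m).comm_inv

end CloseIn

/-! ### Word length in free groups -/

namespace FreeGroup

variable {X : Type*} [DecidableEq X]

/-- The counter in `p` is the number of letters read so far; `y * u` need not be reduced, so it can
exceed the norm during the induction. -/
theorem norm_induction {p : ℕ → FreeGroup X → Prop} (one : p 0 1)
    (step : ∀ n (x : X) (y u : FreeGroup X), (y = of x ∨ y = (of x)⁻¹) → p n u →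
      p (n + 1) (y * u)) (u : FreeGroup X) : p (norm u) u := by
  have key : ∀ L : List (X × Bool), p L.length (mk L) := by
    intro L
    induction L with
    | nil => simpa [← one_eq_mk] using one
    | cons a L ih =>
      obtain ⟨x, b⟩ := a
      have h := step L.length x (mk [(x, b)]) (mk L) (by
        cases b
        · right; simp [of, inv_mk, invRev]
        · left; rfl) ih
      simpa using h
  have h := key u.toWord
  rwa [mk_toWord] at h

theorem natAbs_hom_le (h : FreeGroup X →* Multiplicative ℤ) {H : ℕ}
    (hH : ∀ x, (h (of x)).toAdd.natAbs ≤ H) (u : FreeGroup X) :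
    (h u).toAdd.natAbs ≤ H * norm u := by
  refine norm_induction (p := fun n u => (h u).toAdd.natAbs ≤ H * n) (by simp) ?_ u
  intro n x y u hy ih
  have hx := hH x
  rw [_root_.map_mul, toAdd_mul, mul_add]
  rcases hy with rfl | rfl
  · omega
  · rw [_root_.map_inv, toAdd_inv]; omega

theorem norm_zpow_le (u : FreeGroup X) (n : ℤ) : norm (u ^ n) ≤ norm u * n.natAbs := by
  have key : ∀ n : ℕ, norm (u ^ n) ≤ norm u * n := by
    intro n
    induction n with
    | zero => simp
    | succ n ih =>
      rw [pow_succ, mul_add, mul_one]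
      exact (norm_mul_le _ _).trans (by omega)
  rcases Int.natAbs_eq n with hn | hn
  · rw [hn, zpow_natCast, Int.natAbs_natCast]; exact key _
  · rw [hn, zpow_neg, norm_inv_eq, zpow_natCast, Int.natAbs_neg, Int.natAbs_natCast]; exact key _

theorem exists_norm_map_le {Y : Type*} [DecidableEq Y] [Finite X]
    (f : FreeGroup X →* FreeGroup Y) : ∃ C : ℕ, ∀ u, norm (f u) ≤ C * norm u := by
  cases nonempty_fintype X
  refine ⟨∑ x, norm (f (of x)), fun u => ?_⟩
  refine norm_induction (p := fun n u => norm (f u) ≤ (∑ x, norm (f (of x))) * n) (by simp) ?_ u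
  intro n x y u hy ih
  have h1 : norm (f y) ≤ ∑ x, norm (f (of x)) := by
    have := Finset.single_le_sum (f := fun x => norm (f (of x))) (fun _ _ => Nat.zero_le _)
      (Finset.mem_univ x)
    rcases hy with rfl | rfl
    · exact this
    · rw [_root_.map_inv, norm_inv_eq]; exact this
  rw [_root_.map_mul, mul_add, mul_one]
  exact (norm_mul_le _ _).trans (by omega)

theorem exists_natAbs_hom_le [Finite X] (h : FreeGroup X →* Multiplicative ℤ) :
    ∃ H : ℕ, ∀ u, (h u).toAdd.natAbs ≤ H * norm u := by
  cases nonempty_fintype X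
  exact ⟨∑ x, (h (of x)).toAdd.natAbs, natAbs_hom_le h fun x =>
    Finset.single_le_sum (f := fun x => (h (of x)).toAdd.natAbs) (fun _ _ => Nat.zero_le _)
      (Finset.mem_univ x)⟩

end FreeGroup

/-! ### From relations between generators to area estimates for words -/

namespace CloseIn

open FreeGroup

variable {F : Type*} [Group F] {S : Set F} {X X' : Type*} [DecidableEq X] [DecidableEq X'] {c : ℕ}

theorem hom_apply {f g : FreeGroup X →* F} (h : ∀ x, CloseIn S c (f (of x)) (g (of x)))
    (u : FreeGroup X) : CloseIn S (c * norm u) (f u) (g u) := by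
  refine norm_induction (p := fun n u => CloseIn S (c * n) (f u) (g u)) (by simpa using refl) ?_ u
  intro n x y u hy ih
  have h1 : CloseIn S c (f y) (g y) := by
    rcases hy with rfl | rfl
    · exact h x
    · simpa using (h x).inv
  rw [_root_.map_mul, _root_.map_mul]
  exact (h1.mul ih).mono (by rw [mul_add]; omega)

theorem comm_hom {f : FreeGroup X →* F} {g : F}
    (h : ∀ x, CloseIn S c (f (of x) * g) (g * f (of x))) (u : FreeGroup X) :
    CloseIn S (c * norm u) (f u * g) (g * f u) := by
  -- Commuting with `g` means that `f` agrees with its conjugate by `g`, and closeness of two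
  -- homomorphisms costs only linear area.
  have := hom_apply (f := f) (g := (MulAut.conj g).toMonoidHom.comp f) (S := S) (c := c)
    (fun x => by simpa [CloseIn, mul_assoc] using h x) u
  simpa [CloseIn, mul_assoc] using this

theorem comm_hom_hom {f : FreeGroup X →* F} {g : FreeGroup X' →* F}
    (h : ∀ x x', CloseIn S c (f (of x) * g (of x')) (g (of x') * f (of x)))
    (u : FreeGroup X) (v : FreeGroup X') :
    CloseIn S (c * norm u * norm v) (f u * g v) (g v * f u) :=
  (comm_hom (f := g) (g := f u) (fun x' => (comm_hom (f := f) (fun x => h x x') u).symm) v).symm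

/-- If `f x` is close to `g x * e ^ h x` for all generators `x`, and `e` commutes with `g x`, then
`f u` is close to `g u * e ^ h u` for all words `u`, with quadratic cost. -/
theorem hom_twist [Finite X] {f g : FreeGroup X →* F} {e : F} {h : FreeGroup X →* Multiplicative ℤ}
    (hf : ∀ x, CloseIn S c (f (of x)) (g (of x) * e ^ (h (of x)).toAdd))
    (he : ∀ x, CloseIn S c (g (of x) * e) (e * g (of x))) :
    ∃ C : ℕ, ∀ u : FreeGroup X, CloseIn S (C * norm u ^ 2) (f u) (g u * e ^ (h u).toAdd) := by
  obtain ⟨H, hH⟩ := exists_natAbs_hom_le h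
  refine ⟨c + c * H, fun u => ?_⟩
  have hg : ∀ x, CloseIn S (c * H) (g (of x) * e ^ (h (of x)).toAdd)
      (e ^ (h (of x)).toAdd * g (of x)) := fun x => by
    have h1 := hH (of x)
    rw [norm_of, mul_one] at h1
    exact ((he x).symm.comm_zpow _).symm.mono (Nat.mul_le_mul_left c h1)
  -- `u ↦ g u * e ^ h u` is not a homomorphism of free groups: each new letter `y` requires `e ^ h
  -- y` to be moved past `g u`. The induction therefore also carries the linear cost of commuting
  -- `e` with `g u`.
  refine (norm_induction (p := fun n u => CloseIn S ((c + c * H) * n ^ 2) (f u)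
    (g u * e ^ (h u).toAdd) ∧ CloseIn S (c * n) (g u * e) (e * g u)) ?_ ?_ u).1
  · exact ⟨by simpa using refl, by simpa using refl⟩
  intro n x y u hy ih
  have h1 : CloseIn S (c + c * H) (f y) (g y * e ^ (h y).toAdd) := by
    rcases hy with rfl | rfl
    · exact (hf x).mono (by omega)
    · simpa using (hf x).inv.trans (hg x).inv
  have h2 : CloseIn S c (g y * e) (e * g y) := by
    rcases hy with rfl | rfl
    · exact he x
    · simpa using (he x).comm_inv
  have h3 : (h y).toAdd.natAbs ≤ H := by
    refine (hH y).trans ?_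
    rcases hy with rfl | rfl <;> simp
  constructor
  · have h4 := h1.mul ih.1
    have h5 : CloseIn S (c * n * H) (e ^ (h y).toAdd * g u) (g u * e ^ (h y).toAdd) :=
      (ih.2.symm.comm_zpow _).mono (Nat.mul_le_mul_left _ h3)
    have h6 := h4.trans ((of_eq (l := 0) (by group)).trans
      ((h5.mul_left (g y)).mul_right (e ^ (h u).toAdd)))
    have h7 : g y * (g u * e ^ (h y).toAdd) * e ^ (h u).toAdd =
        g (y * u) * e ^ (h (y * u)).toAdd := by
      rw [_root_.map_mul, _root_.map_mul, toAdd_mul, zpow_add]; group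
    rw [h7, ← _root_.map_mul] at h6
    exact h6.mono (by nlinarith [Nat.zero_le (c * n), Nat.zero_le (c * H * n)])
  · have h4 := (h2.mul_right (g u)).symm
    have h5 := (ih.2.mul_left (g y)).trans
      ((of_eq (l := 0) (by simp [mul_assoc])).trans (h2.mul_right (g u)))
    rw [_root_.map_mul, mul_assoc]
    exact (h5.trans (of_eq (l := 0) (by simp [mul_assoc]))).mono (by rw [mul_add]; omega)

end CloseIn

-- Since `k v` is `k' v` times a power of `j t`, and `k' v` commutes with `j u`, moving `j u` past
-- `k v` merely conjugates `u` by that power of `t`. The cost `a` is paid twice, to leave `k` and to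
-- return to it.
open FreeGroup in
theorem CloseIn.push {F X Z : Type*} [Group F] [DecidableEq X] [DecidableEq Z] {S : Set F}
    {j : FreeGroup Z →* F} {k k' : FreeGroup X →* F} {t : FreeGroup Z} {u : FreeGroup Z}
    {v : FreeGroup X} {a b : ℕ} (q : ℤ) (hk : CloseIn S a (k v) (k' v * (j t)⁻¹ ^ q))
    (hc : CloseIn S b (k' v * j u) (j u * k' v)) :
    CloseIn S (a + b + a) (j u * k v) (k v * j (t ^ q * u * t ^ (-q))) := by
  have h1 := (hk.mul_left (j u)).trans
    ((CloseIn.of_eq (l := 0) (mul_assoc _ _ _).symm).trans (hc.symm.mul_right ((j t)⁻¹ ^ q)))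
  have h2 : k' v * j u * (j t)⁻¹ ^ q = k' v * (j t)⁻¹ ^ q * j (t ^ q * u * t ^ (-q)) := by
    simp only [_root_.map_mul, map_zpow]; group
  rw [h2] at h1
  exact (h1.trans (hk.symm.mul_right _)).mono (by omega)

/-- The relators saying that `f` and `g` have commuting images. -/
def commRels {F X Z : Type*} [Group F] (f : FreeGroup X →* F) (g : FreeGroup Z →* F) : Set F :=
  Set.range fun p : X × Z => f (FreeGroup.of p.1) * g (FreeGroup.of p.2) *
    (g (FreeGroup.of p.2) * f (FreeGroup.of p.1))⁻¹

/-- The relators saying that `f x = g x * e ^ h x` and that `e` commutes with the image of `g`. -/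
def twistRels {F X : Type*} [Group F] (f g : FreeGroup X →* F) (e : F)
    (h : FreeGroup X →* Multiplicative ℤ) : Set F :=
  (Set.range fun x => f (FreeGroup.of x) *
    (g (FreeGroup.of x) * e ^ (h (FreeGroup.of x)).toAdd)⁻¹) ∪
  Set.range fun x => g (FreeGroup.of x) * e * (e * g (FreeGroup.of x))⁻¹

theorem finite_commRels {F X Z : Type*} [Group F] [Finite X] [Finite Z] (f : FreeGroup X →* F)
    (g : FreeGroup Z →* F) : (commRels f g).Finite := Set.finite_range _

theorem finite_twistRels {F X : Type*} [Group F] [Finite X] (f g : FreeGroup X →* F) (e : F)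
    (h : FreeGroup X →* Multiplicative ℤ) : (twistRels f g e h).Finite :=
  (Set.finite_range _).union (Set.finite_range _)

open FreeGroup in
theorem closeIn_of_commRels {F X Z : Type*} [Group F] [DecidableEq X] [DecidableEq Z] {S : Set F}
    {f : FreeGroup X →* F} {g : FreeGroup Z →* F} (h : commRels f g ⊆ S) (u : FreeGroup X)
    (v : FreeGroup Z) : CloseIn S (norm u * norm v) (f u * g v) (g v * f u) := by
  simpa using CloseIn.comm_hom_hom (c := 1)
    (fun x z => FillsIn.of_mem (h ⟨(x, z), rfl⟩)) u v

open FreeGroup in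
theorem closeIn_of_twistRels {F X : Type*} [Group F] [DecidableEq X] [Finite X] {S : Set F}
    {f g : FreeGroup X →* F} {e : F} {h : FreeGroup X →* Multiplicative ℤ}
    (hS : twistRels f g e h ⊆ S) :
    ∃ C : ℕ, ∀ u : FreeGroup X, CloseIn S (C * norm u ^ 2) (f u) (g u * e ^ (h u).toAdd) :=
  CloseIn.hom_twist (c := 1) (fun x => FillsIn.of_mem (hS (.inl ⟨x, rfl⟩)))
    fun x => FillsIn.of_mem (hS (.inr ⟨x, rfl⟩))

/-! ### Normal forms for words in the kernel -/

/-- Homomorphisms of free groups covering the homomorphisms between the kernel of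
`G₁ × G₂ × G₃ → ℤ` and the factors. -/
structure CoverData (X₁ X₂ X₃ Y : Type*) where
  i₁₂ : FreeGroup X₁ →* FreeGroup Y
  i₁₃ : FreeGroup X₁ →* FreeGroup Y
  i₂₁ : FreeGroup X₂ →* FreeGroup Y
  i₂₃ : FreeGroup X₂ →* FreeGroup Y
  i₃₁ : FreeGroup X₃ →* FreeGroup Y
  i₃₂ : FreeGroup X₃ →* FreeGroup Y
  h₁ : FreeGroup X₁ →* Multiplicative ℤ
  h₂ : FreeGroup X₂ →* Multiplicative ℤ
  h₃ : FreeGroup X₃ →* Multiplicative ℤ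
  θ₁ : FreeGroup Y →* FreeGroup X₁
  θ₂ : FreeGroup Y →* FreeGroup X₂
  θ₃ : FreeGroup Y →* FreeGroup X₃
  s : FreeGroup X₂
  t : FreeGroup X₃
  h₃_t : h₃ t = Multiplicative.ofAdd 1
  h_θ : ∀ w, h₁ (θ₁ w) * h₂ (θ₂ w) * h₃ (θ₃ w) = 1

namespace CoverData

open FreeGroup

variable {X₁ X₂ X₃ Y : Type*} (D : CoverData X₁ X₂ X₃ Y)

/-- The sum of the heights of the first two coordinates. -/
def height (w : FreeGroup Y) : ℤ := (D.h₁ (D.θ₁ w)).toAdd + (D.h₂ (D.θ₂ w)).toAdd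

/-- The third factor of the normal form. -/
def third (w : FreeGroup Y) : FreeGroup X₃ := D.t ^ D.height w * D.θ₃ w

/-- The normal form of `w`. -/
def nf (w : FreeGroup Y) : FreeGroup Y := D.i₁₃ (D.θ₁ w) * D.i₂₃ (D.θ₂ w) * D.i₃₁ (D.third w)

/-- The relators that are needed in order to put words into normal form. -/
def rels : Set (FreeGroup Y) :=
  commRels D.i₁₃ D.i₂₃ ∪ commRels D.i₁₂ D.i₃₂ ∪ commRels D.i₂₁ D.i₃₁ ∪
  twistRels D.i₁₃ D.i₁₂ (D.i₃₂ D.t)⁻¹ D.h₁ ∪ twistRels D.i₂₃ D.i₂₁ (D.i₃₁ D.t)⁻¹ D.h₂ ∪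
  twistRels D.i₃₂ D.i₃₁ (D.i₂₁ D.s)⁻¹ D.h₃ ∪
  -- `nf` is not a homomorphism, so generators and their inverses need separate relators.
  (Set.range fun y : Y => of y * (D.nf (of y))⁻¹) ∪
  Set.range fun y : Y => (of y)⁻¹ * (D.nf (of y)⁻¹)⁻¹

theorem finite_rels [Finite X₁] [Finite X₂] [Finite X₃] [Finite Y] : D.rels.Finite :=
  ((((((((finite_commRels _ _).union (finite_commRels _ _)).union (finite_commRels _ _)).union
    (finite_twistRels _ _ _ _)).union (finite_twistRels _ _ _ _)).union
    (finite_twistRels _ _ _ _)).union (Set.finite_range _)).union (Set.finite_range _))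

/-- By `h_θ` the three heights cancel, and `t` has height 1. Height zero is what makes `i₃₁` and
`i₃₂` interchangeable on this factor. -/
theorem h₃_third (w : FreeGroup Y) : (D.h₃ (D.third w)).toAdd = 0 := by
  have h := congrArg Multiplicative.toAdd (D.h_θ w)
  simp only [toAdd_mul, toAdd_one] at h
  simp only [third, height, _root_.map_mul, map_zpow, h₃_t, toAdd_mul, toAdd_zpow, toAdd_ofAdd,
    smul_eq_mul, mul_one]
  exact h

theorem height_mul (w w' : FreeGroup Y) : D.height (w * w') = D.height w + D.height w' := by
  simp only [height, _root_.map_mul, toAdd_mul]; ring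

/-- The conjugation by `t ^ height w'` is exactly what the third factor of `nf w` undergoes when
pushed past the first two factors of `nf w'`. -/
theorem third_mul (w w' : FreeGroup Y) :
    D.third (w * w') = D.t ^ D.height w' * D.third w * D.t ^ (-D.height w') * D.third w' := by
  simp only [third, height_mul, _root_.map_mul]
  rw [add_comm, zpow_add]; group

variable [DecidableEq X₁] [DecidableEq X₂] [DecidableEq X₃] [DecidableEq Y] [Finite Y]

theorem exists_bounds : ∃ L : ℕ, ∀ w, norm (D.θ₁ w) ≤ L * norm w ∧ norm (D.θ₂ w) ≤ L * norm w ∧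
    norm (D.third w) ≤ L * norm w ∧
    (D.h₁ (D.θ₁ w)).toAdd.natAbs ≤ L * norm w := by
  obtain ⟨L₁, h1⟩ := exists_norm_map_le D.θ₁
  obtain ⟨L₂, h2⟩ := exists_norm_map_le D.θ₂
  obtain ⟨L₃, h3⟩ := exists_norm_map_le D.θ₃
  obtain ⟨H₁, h4⟩ := exists_natAbs_hom_le (D.h₁.comp D.θ₁)
  obtain ⟨H₂, h5⟩ := exists_natAbs_hom_le (D.h₂.comp D.θ₂)
  refine ⟨L₁ + L₂ + H₁ + L₃ + norm D.t * (H₁ + H₂), fun w => ?_⟩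
  have h4 : (D.h₁ (D.θ₁ w)).toAdd.natAbs ≤ H₁ * norm w := h4 w
  have h5 : (D.h₂ (D.θ₂ w)).toAdd.natAbs ≤ H₂ * norm w := h5 w
  have h6 : (D.height w).natAbs ≤ (H₁ + H₂) * norm w := by
    rw [add_mul]; exact (Int.natAbs_add_le _ _).trans (add_le_add h4 h5)
  have h7 : norm (D.third w) ≤ norm D.t * (H₁ + H₂) * norm w + L₃ * norm w :=
    (FreeGroup.norm_mul_le _ _).trans (add_le_add ((norm_zpow_le _ _).trans
      (by rw [mul_assoc]; exact Nat.mul_le_mul_left _ h6)) (h3 w))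
  have h1 := h1 w
  have h2 := h2 w
  simp only [add_mul] at *
  refine ⟨?_, ?_, ?_, ?_⟩ <;> omega

variable [Finite X₁] [Finite X₂] [Finite X₃]

/-- Multiplying normal forms takes quadratic area. -/
theorem nf_mul : ∃ C : ℕ, ∀ (m : ℕ) (w w' : FreeGroup Y), norm w ≤ m → norm w' ≤ m →
    CloseIn D.rels (C * m ^ 2) (D.nf w * D.nf w') (D.nf (w * w')) := by
  have hD₃ : commRels D.i₁₃ D.i₂₃ ⊆ D.rels := by intro x hx; simp only [rels, Set.mem_union]; tauto
  have hD₂ : commRels D.i₁₂ D.i₃₂ ⊆ D.rels := by intro x hx; simp only [rels, Set.mem_union]; tauto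
  have hD₁ : commRels D.i₂₁ D.i₃₁ ⊆ D.rels := by intro x hx; simp only [rels, Set.mem_union]; tauto
  obtain ⟨C₁, hT₁⟩ := closeIn_of_twistRels (S := D.rels) (f := D.i₁₃) (g := D.i₁₂)
    (e := (D.i₃₂ D.t)⁻¹) (h := D.h₁) (by intro x hx; simp only [rels, Set.mem_union]; tauto)
  obtain ⟨C₂, hT₂⟩ := closeIn_of_twistRels (S := D.rels) (f := D.i₂₃) (g := D.i₂₁)
    (e := (D.i₃₁ D.t)⁻¹) (h := D.h₂) (by intro x hx; simp only [rels, Set.mem_union]; tauto)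
  obtain ⟨C₃, hT₃⟩ := closeIn_of_twistRels (S := D.rels) (f := D.i₃₂) (g := D.i₃₁)
    (e := (D.i₂₁ D.s)⁻¹) (h := D.h₃) (by intro x hx; simp only [rels, Set.mem_union]; tauto)
  obtain ⟨L, hL⟩ := D.exists_bounds
  -- `M * m` must also bound the conjugate `u'` of `u` by `t ^ q₁`, where `|q₁| ≤ L * m`.
  obtain ⟨M, hM⟩ : ∃ M, M = L + 2 * norm D.t * L := ⟨_, rfl⟩
  have hLM : L ≤ M := by rw [hM]; exact Nat.le_add_right _ _
  refine ⟨2 * C₁ * M ^ 2 + 2 * C₂ * M ^ 2 + 2 * C₃ * M ^ 2 + 3 * M ^ 2, fun m w w' hw hw' => ?_⟩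
  obtain ⟨a1, a2, a3, -⟩ := hL w
  obtain ⟨b1, b2, b3, b4⟩ := hL w'
  have hwm : L * norm w ≤ M * m := Nat.mul_le_mul hLM hw
  have hwm' : L * norm w' ≤ M * m := Nat.mul_le_mul hLM hw'
  set q₁ := (D.h₁ (D.θ₁ w')).toAdd with hq₁
  set q₂ := (D.h₂ (D.θ₂ w')).toAdd with hq₂
  set u := D.third w with hu
  set u' := D.t ^ q₁ * u * D.t ^ (-q₁) with hu'
  have hq : norm (D.t ^ q₁) ≤ norm D.t * L * m := by
    refine (norm_zpow_le _ _).trans ?_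
    rw [mul_assoc]
    exact Nat.mul_le_mul_left _ (b4.trans (Nat.mul_le_mul_left _ hw'))
  have hun : norm u ≤ L * m := a3.trans (Nat.mul_le_mul_left _ hw)
  have hun' : norm u' ≤ M * m := by
    have h1 := FreeGroup.norm_mul_le (D.t ^ q₁ * u) (D.t ^ (-q₁))
    have h2 := FreeGroup.norm_mul_le (D.t ^ q₁) u
    rw [zpow_neg, norm_inv_eq] at h1
    rw [hu', zpow_neg, hM, add_mul, mul_assoc 2, mul_assoc 2]
    omega
  have hunM : norm u ≤ M * m := hun.trans (Nat.mul_le_mul_right _ hLM)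
  have h0 : (D.h₃ u).toAdd = 0 := D.h₃_third w
  have h0' : (D.h₃ u').toAdd = 0 := by simp [hu', h0]
  -- As `u` has height zero, the twist between `i₃₂ u` and `i₃₁ u` is trivial.
  have e0 : CloseIn D.rels (C₃ * (M * m) ^ 2) (D.i₃₂ u) (D.i₃₁ u) := by
    have := hT₃ u
    rw [h0, zpow_zero, mul_one] at this
    exact this.mono (by gcongr)
  have e0' : CloseIn D.rels (C₃ * (M * m) ^ 2) (D.i₃₂ u') (D.i₃₁ u') := by
    have := hT₃ u'
    rw [h0', zpow_zero, mul_one] at this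
    exact this.mono (by gcongr)
  have hb1 := b1.trans hwm'
  have hb2 := b2.trans hwm'
  have ha2 := a2.trans hwm
  -- Written with `i₃₂`, the third factor passes `i₁₃ (θ₁ w')`, because `i₁₂` commutes with `i₃₂`.
  -- Back in the form `i₃₁`, it passes `i₂₃ (θ₂ w')` in `e2`, because `i₂₁` commutes with `i₃₁`.
  have e1 := CloseIn.push (S := D.rels) (j := D.i₃₂) (k := D.i₁₃) (k' := D.i₁₂) (t := D.t) (u := u)
    (v := D.θ₁ w') (a := C₁ * (M * m) ^ 2) (b := (M * m) * (M * m)) q₁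
    ((hT₁ _).mono (by gcongr)) ((closeIn_of_commRels hD₂ _ _).mono (by gcongr))
  have e2 := CloseIn.push (S := D.rels) (j := D.i₃₁) (k := D.i₂₃) (k' := D.i₂₁) (t := D.t) (u := u')
    (v := D.θ₂ w') (a := C₂ * (M * m) ^ 2) (b := (M * m) * (M * m)) q₂
    ((hT₂ _).mono (by gcongr)) ((closeIn_of_commRels hD₁ _ _).mono (by gcongr))
  have e3 : CloseIn D.rels ((M * m) * (M * m)) (D.i₁₃ (D.θ₁ w') * D.i₂₃ (D.θ₂ w))
      (D.i₂₃ (D.θ₂ w) * D.i₁₃ (D.θ₁ w')) :=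
    (closeIn_of_commRels hD₃ _ _).mono (by gcongr)
  have e4 := ((e0.symm.mul_right (D.i₁₃ (D.θ₁ w'))).trans e1).trans
    (e0'.mul_left (D.i₁₃ (D.θ₁ w')))
  have e5 : CloseIn D.rels _ (D.nf w * D.nf w') _ :=
    (CloseIn.of_eq (l := 0) (v := D.i₁₃ (D.θ₁ w) * D.i₂₃ (D.θ₂ w) *
      (D.i₃₁ u * D.i₁₃ (D.θ₁ w')) * (D.i₂₃ (D.θ₂ w') * D.i₃₁ (D.third w')))
      (by simp only [nf, hu, mul_assoc])).trans
    ((e4.mul_left _).mul_right _)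
  have e6 := (e5.trans (CloseIn.of_eq (l := 0) (v := D.i₁₃ (D.θ₁ w) *
      (D.i₂₃ (D.θ₂ w) * D.i₁₃ (D.θ₁ w')) * (D.i₃₁ u' * D.i₂₃ (D.θ₂ w')) * D.i₃₁ (D.third w'))
      (by simp only [mul_assoc]))).trans
    ((((e3.symm.mul_left (D.i₁₃ (D.θ₁ w))).mul e2)).mul_right _)
  -- This is an identity in the free group: the successive conjugations by `t ^ q₁` and `t ^ q₂`
  -- combine into the one in `third_mul`.
  have e7 : D.nf (w * w') = D.i₁₃ (D.θ₁ w) * (D.i₁₃ (D.θ₁ w') * D.i₂₃ (D.θ₂ w)) *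
      (D.i₂₃ (D.θ₂ w') * D.i₃₁ (D.t ^ q₂ * u' * D.t ^ (-q₂))) * D.i₃₁ (D.third w') := by
    rw [nf, third_mul, height, ← hq₁, ← hq₂, ← hu, hu']
    simp only [_root_.map_mul, map_zpow, mul_assoc]
    rw [add_comm q₁ q₂, zpow_add, neg_add, zpow_add]
    simp only [mul_assoc, (Commute.zpow_zpow_self (D.i₃₁ D.t) (-q₂) (-q₁)).left_comm]
  rw [e7]
  exact e6.mono (by ring_nf; omega)

/-- Every word can be put into normal form with quadratic area. -/
theorem closeIn_nf : ∃ C : ℕ, ∀ w : FreeGroup Y, CloseIn D.rels (C * norm w ^ 2) w (D.nf w) := by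
  obtain ⟨C, hC⟩ := D.nf_mul
  have h1 : ∀ (y : Y) (b : Bool), CloseIn D.rels 1 (FreeGroup.mk [(y, b)]) (D.nf (FreeGroup.mk [(y, b)])) := by
    intro y b
    refine FillsIn.of_mem ?_
    cases b
    · have h : (FreeGroup.mk [(y, false)] : FreeGroup Y) = (of y)⁻¹ := by simp [of, inv_mk, invRev]
      rw [h]
      exact .inr ⟨y, rfl⟩
    · exact .inl (.inr ⟨y, rfl⟩)
  -- Induction by halving: appending letters one at a time would add a quadratic cost for each
  -- letter, hence a cubic total.
  have key : ∀ n : ℕ, ∀ L : List (Y × Bool), L.length = n →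
      CloseIn D.rels ((3 * C + 1) * n ^ 2) (FreeGroup.mk L) (D.nf (FreeGroup.mk L)) := by
    intro n
    induction n using Nat.strong_induction_on with
    | _ n ih =>
      intro L hL
      match L, hL with
      | [], _ => exact CloseIn.of_eq (by simp [nf, third, height, ← one_eq_mk])
      | [(y, b)], hL =>
        subst hL
        exact (h1 y b).mono (by simp)
      | a :: b :: L, hL =>
        set M := a :: b :: L with hM
        have h2 : 2 ≤ n := by rw [← hL, hM]; simp
        have e1 := ih (n / 2) (by omega) (M.take (n / 2)) (by simp; omega)
        have e2 := ih (n - n / 2) (by omega) (M.drop (n / 2)) (by simp; omega)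
        have e3 := hC n (FreeGroup.mk (M.take (n / 2))) (FreeGroup.mk (M.drop (n / 2)))
          (norm_mk_le.trans (by simp; omega)) (norm_mk_le.trans (by simp; omega))
        have e4 := (e1.mul e2).trans e3
        rw [mul_mk, List.take_append_drop] at e4
        refine e4.mono ?_
        obtain ⟨a, ha⟩ : ∃ a, a = n / 2 := ⟨_, rfl⟩
        obtain ⟨b, hb⟩ : ∃ b, b = n - a := ⟨_, rfl⟩
        rw [← ha, ← hb]
        have hn : n = a + b := by omega
        have hab : a ≤ b := by omega
        have hba : b ≤ 2 * a := by omega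
        clear ha hb
        subst hn
        -- Splitting `n = a + b` frees `2 * a * b` in the quadratic bound. Balanced halves give `n ^
        -- 2 ≤ 6 * a * b`, so the factor 3 in `3 * C + 1` pays for the merging cost `C * n ^ 2`.
        have hk : (a + b) ^ 2 ≤ 3 * (2 * (a * b)) := by nlinarith
        nlinarith [Nat.mul_le_mul_left C hk, Nat.zero_le (a * b)]
  refine ⟨3 * C + 1, fun w => ?_⟩
  have := key _ w.toWord rfl
  rwa [mk_toWord] at this

end CoverData

/-! ### Lifting homomorphisms, finite presentations and retracts -/

theorem FreeGroup.exists_lift {X F G : Type*} [Group F] [Group G] {f : F →* G}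
    (hf : Function.Surjective f) (g : FreeGroup X →* G) :
    ∃ g' : FreeGroup X →* F, ∀ u, f (g' u) = g u := by
  choose k hk using hf
  refine ⟨FreeGroup.lift fun x => k (g (FreeGroup.of x)), fun u => ?_⟩
  have : f.comp (FreeGroup.lift fun x => k (g (FreeGroup.of x))) = g := by
    ext x; simp [hk]
  exact DFunLike.congr_fun this u

namespace FillsIn

variable {F : Type*} [Group F] {S T : Set F} {k l : ℕ} {w : F}

theorem mono_set (h : FillsIn S l w) (hST : S ⊆ T) : FillsIn T l w := by
  obtain ⟨L, h1, h2, h3⟩ := h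
  exact ⟨L, h1, fun p hp => (h2 p hp).imp (@hST _) (@hST _), h3⟩

end FillsIn

theorem Group.isFinitelyPresented_of_ker {X G : Type*} [Finite X] [Group G] (f : FreeGroup X →* G)
    (hf : Function.Surjective f) {S : Set (FreeGroup X)} (hS : S.Finite)
    (h : f.ker = Subgroup.normalClosure S) : Group.IsFinitelyPresented G := by
  have : Finite S := hS
  have h1 : Group.IsFinitelyPresented (PresentedGroup S) :=
    Group.IsFinitelyPresented.quotient _ ⟨S, hS, rfl⟩
  exact @Group.IsFinitelyPresented.equiv (PresentedGroup S) G _ _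
    ((QuotientGroup.quotientMulEquivOfEq h.symm).trans
      (QuotientGroup.quotientKerEquivOfSurjective f hf)) h1

theorem Group.IsFinitelyPresented.exists_finitePresentation {G : Type*} [Group G]
    (hG : Group.IsFinitelyPresented G) : ∃ n : ℕ, Nonempty (FinitePresentation (Fin n) G) := by
  obtain ⟨n, f, hf, S, hS, h⟩ := hG.out
  exact ⟨n, ⟨⟨inferInstance, S, hS, f, hf, h.symm⟩⟩⟩

namespace FinitePresentation

open FreeGroup

variable {X G : Type*} [Group G] (P : FinitePresentation X G)

theorem hom_eq_one_of_mem {r : FreeGroup X} (hr : r ∈ P.rels) : P.hom r = 1 := by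
  have : r ∈ P.hom.ker := P.ker_hom ▸ Subgroup.subset_normalClosure hr
  exact this

theorem fillsIn_area {w : FreeGroup X} (hw : P.hom w = 1) : FillsIn P.rels (P.area w) w := by
  obtain ⟨L, h1, h2, h3⟩ := P.hasFilling_area hw
  exact ⟨L, h1.le, h2, h3⟩

theorem area_le {w : FreeGroup X} {l : ℕ} (h : FillsIn P.rels l w) : P.area w ≤ l := by
  obtain ⟨L, h1, h2, h3⟩ := h
  exact (Nat.sInf_le (s := {l | P.HasFilling w l}) ⟨L, rfl, h2, h3⟩).trans h1

theorem dehn_mono : Monotone P.dehn := by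
  intro m n hmn
  obtain ⟨w, h1, h2, h3⟩ := (P.isGreatest_dehn m).1
  exact (P.isGreatest_dehn n).2 ⟨w, h1.trans hmn, h2, h3⟩

section

variable [DecidableEq X]

theorem area_le_dehn {w : FreeGroup X} (hw : P.hom w = 1) {n : ℕ} (hn : norm w ≤ n) :
    P.area w ≤ P.dehn n :=
  (P.isGreatest_dehn n).2 ⟨w.toWord, hn, by rwa [mk_toWord], by rw [mk_toWord]⟩

theorem fillsIn_dehn {w : FreeGroup X} (hw : P.hom w = 1) {n : ℕ} (hn : norm w ≤ n) :
    FillsIn P.rels (P.dehn n) w :=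
  (P.fillsIn_area hw).mono (P.area_le_dehn hw hn)

theorem dehn_le {n b : ℕ} (h : ∀ w : FreeGroup X, norm w ≤ n → P.hom w = 1 → FillsIn P.rels b w) :
    P.dehn n ≤ b := by
  obtain ⟨w, h1, h2, h3⟩ := (P.isGreatest_dehn n).1
  rw [h3]
  exact P.area_le (h _ (norm_mk_le.trans h1) h2)

end

theorem exists_fillsIn {T : Set (FreeGroup X)} (hT : T.Finite) (h : ∀ r ∈ T, P.hom r = 1) :
    ∃ M, ∀ r ∈ T, FillsIn P.rels M r := by
  obtain ⟨M, hM⟩ := (hT.image P.area).bddAbove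
  exact ⟨M, fun r hr => (P.fillsIn_area (h r hr)).mono (hM ⟨r, hr, rfl⟩)⟩

theorem exists_closeIn {ι : Type*} [Finite ι] {f g : ι → FreeGroup X}
    (h : ∀ i, P.hom (f i) = P.hom (g i)) : ∃ M, ∀ i, CloseIn P.rels M (f i) (g i) := by
  obtain ⟨M, hM⟩ := P.exists_fillsIn (Set.finite_range fun i => f i * (g i)⁻¹) (by
    rintro _ ⟨i, rfl⟩; simp [h])
  exact ⟨M, fun i => hM _ ⟨i, rfl⟩⟩

/-- A homomorphism of free groups that covers a homomorphism of the presented groups is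
Lipschitz with respect to area. -/
theorem exists_fillsIn_map {Z H : Type*} [Group H] (Q : FinitePresentation Z H) {g : G →* H}
    {f : FreeGroup X →* FreeGroup Z} (hf : ∀ u, Q.hom (f u) = g (P.hom u)) :
    ∃ M : ℕ, ∀ l w, FillsIn P.rels l w → FillsIn Q.rels (M * l) (f w) := by
  obtain ⟨M, hM⟩ := Q.exists_fillsIn (P.finite_rels.image f) (by
    rintro _ ⟨r, hr, rfl⟩; rw [hf, P.hom_eq_one_of_mem hr, _root_.map_one])
  exact ⟨M, fun l w h => h.map f fun r hr => hM _ ⟨r, hr, rfl⟩⟩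

open Classical in
/-- The Dehn function of a retract is bounded by that of the group. -/
theorem dehn_le_of_retract {Z H : Type*} [Group H] (Q : FinitePresentation Z H) (i : G →* H)
    (r : H →* G) (hri : ∀ g, r (i g) = g) :
    ∃ C : ℕ, ∀ n, P.dehn n ≤ C * Q.dehn (C * n) + C * n := by
  have := P.finite_gens
  obtain ⟨i', hi'⟩ := exists_lift Q.hom_surjective (i.comp P.hom)
  obtain ⟨r', hr'⟩ := exists_lift P.hom_surjective (r.comp Q.hom)
  obtain ⟨M, hM⟩ := Q.exists_fillsIn_map P (g := r) hr'
  obtain ⟨L, hL⟩ := exists_norm_map_le i'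
  obtain ⟨c, hc⟩ := P.exists_closeIn (f := fun x => of x) (g := fun x => r' (i' (of x)))
    (fun x => by rw [hr', MonoidHom.comp_apply, hi', MonoidHom.comp_apply, hri])
  refine ⟨M + L + c, fun n => P.dehn_le fun w hw hw1 => ?_⟩
  have h1 := hM _ _ (Q.fillsIn_dehn (w := i' w) (by rw [hi', MonoidHom.comp_apply, hw1, _root_.map_one])
    ((hL w).trans (Nat.mul_le_mul_left _ hw)))
  -- `r' ∘ i'` covers the identity of `G`, so it moves each word by an area linear in its length;
  -- the filling of `i' w` is then transported by `r'`.
  have h2 : CloseIn P.rels (c * norm w) w (r' (i' w)) :=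
    CloseIn.hom_apply (f := MonoidHom.id _) (g := r'.comp i') hc w
  have h3 : FillsIn P.rels _ (w * (r' (i' w))⁻¹ * r' (i' w)) := FillsIn.mul h2 h1
  rw [inv_mul_cancel_right] at h3
  refine h3.mono ?_
  have h4 : Q.dehn (L * n) ≤ Q.dehn ((M + L + c) * n) := Q.dehn_mono (by gcongr; omega)
  have h5 : M * Q.dehn (L * n) ≤ (M + L + c) * Q.dehn ((M + L + c) * n) :=
    Nat.mul_le_mul (by omega) h4
  have h6 : c * norm w ≤ (M + L + c) * n := Nat.mul_le_mul (by omega) hw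
  omega

end FinitePresentation

/-! ### The quadratic lower bound -/

/-- The integral Heisenberg group. -/
@[ext]
structure Heisenberg where
  x : ℤ
  y : ℤ
  z : ℤ

namespace Heisenberg

instance : Mul Heisenberg := ⟨fun a b => ⟨a.x + b.x, a.y + b.y, a.z + b.z + a.x * b.y⟩⟩

instance : One Heisenberg := ⟨⟨0, 0, 0⟩⟩

instance : Inv Heisenberg := ⟨fun a => ⟨-a.x, -a.y, -a.z + a.x * a.y⟩⟩

@[simp] theorem mul_x (a b : Heisenberg) : (a * b).x = a.x + b.x := rfl
@[simp] theorem mul_y (a b : Heisenberg) : (a * b).y = a.y + b.y := rfl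
@[simp] theorem mul_z (a b : Heisenberg) : (a * b).z = a.z + b.z + a.x * b.y := rfl
@[simp] theorem one_x : (1 : Heisenberg).x = 0 := rfl
@[simp] theorem one_y : (1 : Heisenberg).y = 0 := rfl
@[simp] theorem one_z : (1 : Heisenberg).z = 0 := rfl
@[simp] theorem inv_x (a : Heisenberg) : (a⁻¹).x = -a.x := rfl
@[simp] theorem inv_y (a : Heisenberg) : (a⁻¹).y = -a.y := rfl
@[simp] theorem inv_z (a : Heisenberg) : (a⁻¹).z = -a.z + a.x * a.y := rfl

instance : Group Heisenberg :=
  Group.ofLeftAxioms (fun a b c => by ext <;> simp <;> ring) (fun a => by ext <;> simp)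
    (fun a => by ext <;> simp)

theorem pow_of_y_eq_zero {a : Heisenberg} (ha : a.y = 0) (n : ℕ) :
    a ^ n = ⟨n * a.x, 0, n * a.z⟩ := by
  induction n with
  | zero => ext <;> simp
  | succ n ih => rw [pow_succ, ih]; ext <;> simp [ha] <;> ring

theorem pow_of_x_eq_zero {a : Heisenberg} (ha : a.x = 0) (n : ℕ) :
    a ^ n = ⟨0, n * a.y, n * a.z⟩ := by
  induction n with
  | zero => ext <;> simp
  | succ n ih => rw [pow_succ, ih]; ext <;> simp [ha] <;> ring

/-- The first coordinate as a homomorphism. -/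
def xHom : Heisenberg →* Multiplicative ℤ where
  toFun a := Multiplicative.ofAdd a.x
  map_one' := rfl
  map_mul' _ _ := rfl

/-- The second coordinate as a homomorphism. -/
def yHom : Heisenberg →* Multiplicative ℤ where
  toFun a := Multiplicative.ofAdd a.y
  map_one' := rfl
  map_mul' _ _ := rfl

/-- Elements with `x = y = 0` are central, so conjugation does not change `z`, and `z` is additive
on them. Thus `z` bounds area from below. -/
theorem natAbs_z_prod_le {F : Type*} [Group F] (f : F →* Heisenberg) {S : Set F} {M : ℕ}
    (hS : ∀ r ∈ S, (f r).x = 0 ∧ (f r).y = 0 ∧ (f r).z.natAbs ≤ M) :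
    ∀ L : List (F × F), (∀ p ∈ L, p.2 ∈ S ∨ p.2⁻¹ ∈ S) →
      (f (L.map fun p => p.1 * p.2 * p.1⁻¹).prod).x = 0 ∧
      (f (L.map fun p => p.1 * p.2 * p.1⁻¹).prod).y = 0 ∧
      (f (L.map fun p => p.1 * p.2 * p.1⁻¹).prod).z.natAbs ≤ M * L.length
  | [], _ => by simp
  | p :: L, h => by
    obtain ⟨h1, h2, h3⟩ := natAbs_z_prod_le f hS L fun q hq => h q (by simp [hq])
    have h4 : (f p.2).x = 0 ∧ (f p.2).y = 0 ∧ (f p.2).z.natAbs ≤ M := by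
      rcases h p (by simp) with h | h
      · exact hS _ h
      · obtain ⟨h4, h5, h6⟩ := hS _ h
        rw [map_inv, inv_x, neg_eq_zero] at h4
        rw [map_inv, inv_y, neg_eq_zero] at h5
        rw [map_inv, inv_z, h4, zero_mul, add_zero, Int.natAbs_neg] at h6
        exact ⟨h4, h5, h6⟩
    obtain ⟨h4, h5, h6⟩ := h4
    have h7 : (f (p.1 * p.2 * p.1⁻¹)).z = (f p.2).z := by
      simp only [map_mul, map_inv, mul_z, inv_z, mul_x, inv_y, h4, h5]; ring
    rw [List.map_cons, List.prod_cons, map_mul]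
    refine ⟨by simp [h1, h4], by simp [h2, h5], ?_⟩
    rw [mul_z, h7, h2, mul_zero, add_zero, List.length_cons, mul_add, mul_one]
    exact (Int.natAbs_add_le _ _).trans (by omega)

end Heisenberg

open FreeGroup Classical in
/-- A finitely presented group that retracts onto `ℤ²` has an at least quadratic Dehn function. -/
theorem FinitePresentation.sq_le_dehn {X G : Type*} [Group G] (P : FinitePresentation X G)
    (p q : G →* Multiplicative ℤ) (a b : G) (hab : Commute a b)
    (hpa : p a = Multiplicative.ofAdd 1) (hpb : p b = 1) (hqa : q a = 1)
    (hqb : q b = Multiplicative.ofAdd 1) : ∃ C : ℕ, ∀ n, n ^ 2 ≤ C * P.dehn (C * n) := by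
  -- Any lift of `(p, q)` from `ℤ²` to the Heisenberg group works. Relators have trivial image in
  -- `ℤ²`, hence central image, and `M` bounds its size.
  set f : FreeGroup X →* Heisenberg := FreeGroup.lift fun x =>
    ⟨(p (P.hom (of x))).toAdd, (q (P.hom (of x))).toAdd, 0⟩ with hf
  have hx : ∀ w, (f w).x = (p (P.hom w)).toAdd := by
    have : Heisenberg.xHom.comp f = p.comp P.hom := by
      ext x; simp [hf, Heisenberg.xHom]
    exact fun w => congrArg Multiplicative.toAdd (DFunLike.congr_fun this w)
  have hy : ∀ w, (f w).y = (q (P.hom w)).toAdd := by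
    have : Heisenberg.yHom.comp f = q.comp P.hom := by
      ext x; simp [hf, Heisenberg.yHom]
    exact fun w => congrArg Multiplicative.toAdd (DFunLike.congr_fun this w)
  obtain ⟨M, hM⟩ := (P.finite_rels.image fun r => (f r).z.natAbs).bddAbove
  obtain ⟨α, hα⟩ := P.hom_surjective a
  obtain ⟨β, hβ⟩ := P.hom_surjective b
  refine ⟨M + 2 * (norm α + norm β), fun n => ?_⟩
  -- The commutator has length linear in `n`, while its central coordinate is `n ^ 2`, whatever the
  -- `z`-coordinates of `f α` and `f β`.
  set w := α ^ n * β ^ n * (α ^ n)⁻¹ * (β ^ n)⁻¹ with hw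
  have hw1 : P.hom w = 1 := by
    simp only [hw, _root_.map_mul, map_pow, _root_.map_inv, hα, hβ]
    rw [(hab.pow_pow n n).eq]; group
  have hfα : f α ^ n = ⟨n, 0, n * (f α).z⟩ := by
    rw [Heisenberg.pow_of_y_eq_zero (by rw [hy, hα, hqa]; rfl), hx, hα, hpa]; simp
  have hfβ : f β ^ n = ⟨0, n, n * (f β).z⟩ := by
    rw [Heisenberg.pow_of_x_eq_zero (by rw [hx, hβ, hpb]; rfl), hy, hβ, hqb]; simp
  have hfw : (f w).z = (n : ℤ) ^ 2 := by
    simp only [hw, _root_.map_mul, map_pow, _root_.map_inv, hfα, hfβ, Heisenberg.mul_z,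
      Heisenberg.mul_x, Heisenberg.inv_x, Heisenberg.inv_y, Heisenberg.inv_z]
    ring
  have hn : norm w ≤ (M + 2 * (norm α + norm β)) * n := by
    have h1 := FreeGroup.norm_mul_le (α ^ n * β ^ n * (α ^ n)⁻¹) (β ^ n)⁻¹
    have h2 := FreeGroup.norm_mul_le (α ^ n * β ^ n) (α ^ n)⁻¹
    have h3 := FreeGroup.norm_mul_le (α ^ n) (β ^ n)
    have h4 := norm_zpow_le α n
    have h5 := norm_zpow_le β n
    rw [zpow_natCast, Int.natAbs_natCast] at h4 h5
    rw [norm_inv_eq] at h1 h2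
    rw [← hw] at h1
    have h6 : norm w ≤ 2 * (norm α * n) + 2 * (norm β * n) := by omega
    refine h6.trans ?_
    have : 2 * (norm α * n) + 2 * (norm β * n) = 2 * (norm α + norm β) * n := by ring
    rw [this]
    exact Nat.mul_le_mul_right _ (by omega)
  obtain ⟨L, h1, h2, h3⟩ := P.fillsIn_dehn hw1 hn
  have h4 := (Heisenberg.natAbs_z_prod_le f (M := M) (fun r hr =>
    ⟨by rw [hx, P.hom_eq_one_of_mem hr, _root_.map_one]; rfl,
     by rw [hy, P.hom_eq_one_of_mem hr, _root_.map_one]; rfl, hM ⟨r, hr, rfl⟩⟩) L h2).2.2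
  rw [← h3, hfw, Int.natAbs_pow, Int.natAbs_natCast] at h4
  exact h4.trans (Nat.mul_le_mul (by omega) h1)

/-! ### Splitting words into three commuting coordinates -/

open FreeGroup in
/-- If `k x = f₁ x * f₂ x * f₃ x` for all generators `x`, where the `fᵢ` commute with each other,
then `k u = f₁ u * f₂ u * f₃ u` for all words `u`, with quadratic cost. -/
theorem CloseIn.hom_prod_three {F X : Type*} [Group F] [DecidableEq X] {S : Set F} {c : ℕ}
    {k f₁ f₂ f₃ : FreeGroup X →* F}
    (hk : ∀ x, CloseIn S c (k (of x)) (f₁ (of x) * f₂ (of x) * f₃ (of x)))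
    (h₁₂ : ∀ x y, CloseIn S c (f₁ (of x) * f₂ (of y)) (f₂ (of y) * f₁ (of x)))
    (h₁₃ : ∀ x y, CloseIn S c (f₁ (of x) * f₃ (of y)) (f₃ (of y) * f₁ (of x)))
    (h₂₃ : ∀ x y, CloseIn S c (f₂ (of x) * f₃ (of y)) (f₃ (of y) * f₂ (of x)))
    (u : FreeGroup X) : CloseIn S (4 * c * norm u ^ 2) (k u) (f₁ u * f₂ u * f₃ u) := by
  refine (norm_induction (p := fun n u => norm u ≤ n ∧
    CloseIn S (4 * c * n ^ 2) (k u) (f₁ u * f₂ u * f₃ u)) ?_ ?_ u).2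
  · exact ⟨by simp, by simpa using refl⟩
  intro n x y u hy ih
  obtain ⟨hn, ih⟩ := ih
  have hy1 : norm y ≤ 1 := by rcases hy with rfl | rfl <;> simp
  have c₁₂ : CloseIn S (c * n) (f₂ y * f₁ u) (f₁ u * f₂ y) :=
    (comm_hom_hom h₁₂ u y).symm.mono (by simpa using Nat.mul_le_mul (Nat.mul_le_mul_left c hn) hy1)
  have c₁₃ : CloseIn S (c * n) (f₃ y * f₁ u) (f₁ u * f₃ y) :=
    (comm_hom_hom h₁₃ u y).symm.mono (by simpa using Nat.mul_le_mul (Nat.mul_le_mul_left c hn) hy1)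
  have c₂₃ : CloseIn S (c * n) (f₃ y * f₂ u) (f₂ u * f₃ y) :=
    (comm_hom_hom h₂₃ u y).symm.mono (by simpa using Nat.mul_le_mul (Nat.mul_le_mul_left c hn) hy1)
  have h1 : CloseIn S (4 * c) (k y) (f₁ y * f₂ y * f₃ y) := by
    rcases hy with rfl | rfl
    · exact (hk x).mono (by omega)
    -- Inversion reverses the three factors; three commutations restore their order, hence `4 * c`.
    · have e1 := (h₁₂ x x).inv
      have e2 := (h₁₃ x x).inv
      have e3 := (h₂₃ x x).inv
      have e4 := (hk x).inv
      simp only [mul_inv_rev] at e1 e2 e3 e4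
      simp only [_root_.map_inv]
      have e5 := (e4.trans ((e1.mul_left (f₃ (of x))⁻¹))).trans
        ((of_eq (l := 0) (mul_assoc _ _ _).symm).trans (e2.mul_right (f₂ (of x))⁻¹))
      have e6 := e5.trans
        ((of_eq (l := 0) (mul_assoc _ _ _)).trans (e3.mul_left (f₁ (of x))⁻¹))
      exact (e6.trans (of_eq (l := 0) (mul_assoc _ _ _).symm)).mono (by omega)
  refine ⟨(FreeGroup.norm_mul_le _ _).trans (by omega), ?_⟩
  have e1 := (h1.mul ih).trans ((of_eq (l := 0)
    (v := f₁ y * f₂ y * (f₃ y * f₁ u) * (f₂ u * f₃ u)) (by simp only [mul_assoc])).trans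
    ((c₁₃.mul_left (f₁ y * f₂ y)).mul_right (f₂ u * f₃ u)))
  have e2 := e1.trans ((of_eq (l := 0)
    (v := f₁ y * (f₂ y * f₁ u) * (f₃ y * f₂ u * f₃ u)) (by simp only [mul_assoc])).trans
    ((c₁₂.mul_left (f₁ y)).mul (c₂₃.mul_right (f₃ u))))
  have e3 := e2.trans (of_eq (l := 0) (v := f₁ (y * u) * f₂ (y * u) * f₃ (y * u))
    (by simp only [_root_.map_mul, mul_assoc]))
  rw [_root_.map_mul]
  exact e3.mono (by ring_nf; nlinarith [Nat.zero_le (c * n)])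

theorem map_eq_one_of_mem_commRels {F X Z H : Type*} [Group F] [Group H] {π : F →* H}
    {f : FreeGroup X →* F} {g : FreeGroup Z →* F} (h : ∀ u v, Commute (π (f u)) (π (g v)))
    {r : F} (hr : r ∈ commRels f g) : π r = 1 := by
  obtain ⟨p, rfl⟩ := hr
  simp only [map_mul, map_inv, (h _ _).eq, mul_inv_cancel]

theorem map_eq_one_of_mem_twistRels {F X H : Type*} [Group F] [Group H] {π : F →* H}
    {f g : FreeGroup X →* F} {e : F} {h : FreeGroup X →* Multiplicative ℤ}
    (hf : ∀ u, π (f u) = π (g u) * π e ^ (h u).toAdd) (hg : ∀ u, Commute (π (g u)) (π e))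
    {r : F} (hr : r ∈ twistRels f g e h) : π r = 1 := by
  rcases hr with ⟨x, rfl⟩ | ⟨x, rfl⟩
  · simp only [map_mul, map_inv, map_zpow, hf, mul_inv_cancel]
  · simp only [map_mul, map_inv, (hg _).eq, mul_inv_cancel]

/-- A homomorphism to `G` with a commuting splitting of `φ` can be corrected so that it takes
values in the kernel of `φ`. -/
theorem MonoidHom.exists_toKer {G H A : Type*} [Group G] [Group H] [CommGroup A] (φ : G →* A)
    (j : H →* G) (k : A →* G) (hjk : ∀ g n, Commute (j g) (k n)) (hk : ∀ n, φ (k n) = n) :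
    ∃ J : H →* φ.ker, ∀ g, (J g : G) = j g * k (φ (j g))⁻¹ :=
  ⟨MonoidHom.mk' (fun g => ⟨j g * k (φ (j g))⁻¹, by simp [MonoidHom.mem_ker, hk]⟩) fun a b => by
    ext
    simp only [map_mul, mul_inv, Subgroup.coe_mul]
    have := (hjk b (φ (j a))⁻¹).eq
    simp only [mul_assoc]
    rw [← mul_assoc (k (φ (j a))⁻¹), ← this]
    simp only [mul_assoc], fun _ => rfl⟩

/-! ### The maps from the factors to the kernel, and relators for the kernel -/

section Kernel

variable {G₁ G₂ G₃ : Type*} [Group G₁] [Group G₂] [Group G₃] (φ : G₁ × G₂ × G₃ →* Multiplicative ℤ)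

theorem map_eq_mul_three (a : G₁) (b : G₂) (c : G₃) :
    φ (a, b, c) = φ (a, 1, 1) * φ (1, b, 1) * φ (1, 1, c) := by
  rw [← map_mul, ← map_mul]; simp

theorem map_zpow_fst {t : G₁} (ht : φ (t, 1, 1) = Multiplicative.ofAdd 1) (n : Multiplicative ℤ) :
    φ (t ^ n.toAdd, 1, 1) = n := by
  have : ((t ^ n.toAdd, 1, 1) : G₁ × G₂ × G₃) = (t, 1, 1) ^ n.toAdd := by ext <;> simp
  rw [this, map_zpow, ht, ← ofAdd_zsmul]; simp

theorem map_zpow_snd {t : G₂} (ht : φ (1, t, 1) = Multiplicative.ofAdd 1) (n : Multiplicative ℤ) :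
    φ (1, t ^ n.toAdd, 1) = n := by
  have : ((1, t ^ n.toAdd, 1) : G₁ × G₂ × G₃) = (1, t, 1) ^ n.toAdd := by ext <;> simp
  rw [this, map_zpow, ht, ← ofAdd_zsmul]; simp

theorem map_zpow_thd {t : G₃} (ht : φ (1, 1, t) = Multiplicative.ofAdd 1) (n : Multiplicative ℤ) :
    φ (1, 1, t ^ n.toAdd) = n := by
  have : ((1, 1, t ^ n.toAdd) : G₁ × G₂ × G₃) = (1, 1, t) ^ n.toAdd := by ext <;> simp
  rw [this, map_zpow, ht, ← ofAdd_zsmul]; simp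

/-- The inclusion of the first factor. -/
def inFst : G₁ →* G₁ × G₂ × G₃ := MonoidHom.inl _ _

/-- The inclusion of the second factor. -/
def inSnd : G₂ →* G₁ × G₂ × G₃ := (MonoidHom.inr _ _).comp (MonoidHom.inl _ _)

/-- The inclusion of the third factor. -/
def inThd : G₃ →* G₁ × G₂ × G₃ := (MonoidHom.inr _ _).comp (MonoidHom.inr _ _)

@[simp] theorem inFst_apply (g : G₁) : (inFst g : G₁ × G₂ × G₃) = (g, 1, 1) := rfl
@[simp] theorem inSnd_apply (g : G₂) : (inSnd g : G₁ × G₂ × G₃) = (1, g, 1) := rfl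
@[simp] theorem inThd_apply (g : G₃) : (inThd g : G₁ × G₂ × G₃) = (1, 1, g) := rfl

/-- The homomorphisms `Gᵢ → ker φ` that correct the height in the factor `Gⱼ`. -/
structure KerHoms (t₁ : G₁) (t₂ : G₂) (t₃ : G₃) where
  J₁₂ : G₁ →* φ.ker
  J₁₃ : G₁ →* φ.ker
  J₂₁ : G₂ →* φ.ker
  J₂₃ : G₂ →* φ.ker
  J₃₁ : G₃ →* φ.ker
  J₃₂ : G₃ →* φ.ker
  coe_J₁₂ : ∀ g, (J₁₂ g : G₁ × G₂ × G₃) = (g, t₂ ^ (-(φ (g, 1, 1)).toAdd), 1)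
  coe_J₁₃ : ∀ g, (J₁₃ g : G₁ × G₂ × G₃) = (g, 1, t₃ ^ (-(φ (g, 1, 1)).toAdd))
  coe_J₂₁ : ∀ g, (J₂₁ g : G₁ × G₂ × G₃) = (t₁ ^ (-(φ (1, g, 1)).toAdd), g, 1)
  coe_J₂₃ : ∀ g, (J₂₃ g : G₁ × G₂ × G₃) = (1, g, t₃ ^ (-(φ (1, g, 1)).toAdd))
  coe_J₃₁ : ∀ g, (J₃₁ g : G₁ × G₂ × G₃) = (t₁ ^ (-(φ (1, 1, g)).toAdd), 1, g)
  coe_J₃₂ : ∀ g, (J₃₂ g : G₁ × G₂ × G₃) = (1, t₂ ^ (-(φ (1, 1, g)).toAdd), g)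
  map_t₁ : φ (t₁, 1, 1) = Multiplicative.ofAdd 1
  map_t₂ : φ (1, t₂, 1) = Multiplicative.ofAdd 1
  map_t₃ : φ (1, 1, t₃) = Multiplicative.ofAdd 1

theorem exists_kerHoms (h₁ : Function.Surjective fun g : G₁ => φ (g, 1, 1))
    (h₂ : Function.Surjective fun g : G₂ => φ (1, g, 1))
    (h₃ : Function.Surjective fun g : G₃ => φ (1, 1, g)) :
    ∃ t₁ t₂ t₃, Nonempty (KerHoms φ t₁ t₂ t₃) := by
  obtain ⟨t₁, ht₁⟩ := h₁ (Multiplicative.ofAdd 1)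
  obtain ⟨t₂, ht₂⟩ := h₂ (Multiplicative.ofAdd 1)
  obtain ⟨t₃, ht₃⟩ := h₃ (Multiplicative.ofAdd 1)
  have k₁ : ∀ n, φ ((inFst.comp (zpowersHom G₁ t₁)) n) = n := map_zpow_fst φ ht₁
  have k₂ : ∀ n, φ ((inSnd.comp (zpowersHom G₂ t₂)) n) = n := map_zpow_snd φ ht₂
  have k₃ : ∀ n, φ ((inThd.comp (zpowersHom G₃ t₃)) n) = n := map_zpow_thd φ ht₃
  obtain ⟨J₁₂, e₁₂⟩ := φ.exists_toKer inFst _ (fun g n => by ext <;> simp) k₂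
  obtain ⟨J₁₃, e₁₃⟩ := φ.exists_toKer inFst _ (fun g n => by ext <;> simp) k₃
  obtain ⟨J₂₁, e₂₁⟩ := φ.exists_toKer inSnd _ (fun g n => by ext <;> simp) k₁
  obtain ⟨J₂₃, e₂₃⟩ := φ.exists_toKer inSnd _ (fun g n => by ext <;> simp) k₃
  obtain ⟨J₃₁, e₃₁⟩ := φ.exists_toKer inThd _ (fun g n => by ext <;> simp) k₁
  obtain ⟨J₃₂, e₃₂⟩ := φ.exists_toKer inThd _ (fun g n => by ext <;> simp) k₂
  exact ⟨t₁, t₂, t₃, ⟨⟨J₁₂, J₁₃, J₂₁, J₂₃, J₃₁, J₃₂, fun g => by rw [e₁₂]; simp,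
    fun g => by rw [e₁₃]; simp, fun g => by rw [e₂₁]; simp, fun g => by rw [e₂₃]; simp,
    fun g => by rw [e₃₁]; simp, fun g => by rw [e₃₂]; simp, ht₁, ht₂, ht₃⟩⟩⟩

variable {φ}

open FreeGroup Classical in
/-- A finite set of relators of the kernel such that the area of words with respect to these
relators is controlled by the Dehn functions of the factors. -/
theorem KerHoms.exists_relators {t₁ : G₁} {t₂ : G₂} {t₃ : G₃} (J : KerHoms φ t₁ t₂ t₃)
    {X₁ X₂ X₃ Y : Type*} [Finite Y] (P₁ : FinitePresentation X₁ G₁) (P₂ : FinitePresentation X₂ G₂)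
    (P₃ : FinitePresentation X₃ G₃) (π : FreeGroup Y →* φ.ker) (hπ : Function.Surjective π) :
    ∃ S : Set (FreeGroup Y), S.Finite ∧ (∀ r ∈ S, π r = 1) ∧ ∃ C : ℕ, ∀ (n : ℕ) (w : FreeGroup Y), norm w ≤ n →
      π w = 1 → FillsIn S (C * n ^ 2 +
        (P₁.dehn (C * n) + P₂.dehn (C * n) + P₃.dehn (C * n))) w := by
  have := P₁.finite_gens
  have := P₂.finite_gens
  have := P₃.finite_gens
  obtain ⟨i₁₂, hi₁₂⟩ := exists_lift hπ (J.J₁₂.comp P₁.hom)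
  obtain ⟨i₁₃, hi₁₃⟩ := exists_lift hπ (J.J₁₃.comp P₁.hom)
  obtain ⟨i₂₁, hi₂₁⟩ := exists_lift hπ (J.J₂₁.comp P₂.hom)
  obtain ⟨i₂₃, hi₂₃⟩ := exists_lift hπ (J.J₂₃.comp P₂.hom)
  obtain ⟨i₃₁, hi₃₁⟩ := exists_lift hπ (J.J₃₁.comp P₃.hom)
  obtain ⟨i₃₂, hi₃₂⟩ := exists_lift hπ (J.J₃₂.comp P₃.hom)
  obtain ⟨θ₁, hθ₁⟩ := exists_lift P₁.hom_surjective
    (((MonoidHom.fst G₁ (G₂ × G₃)).comp φ.ker.subtype).comp π)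
  obtain ⟨θ₂, hθ₂⟩ := exists_lift P₂.hom_surjective
    ((((MonoidHom.fst G₂ G₃).comp (MonoidHom.snd G₁ (G₂ × G₃))).comp φ.ker.subtype).comp π)
  obtain ⟨θ₃, hθ₃⟩ := exists_lift P₃.hom_surjective
    ((((MonoidHom.snd G₂ G₃).comp (MonoidHom.snd G₁ (G₂ × G₃))).comp φ.ker.subtype).comp π)
  obtain ⟨s, hs⟩ := P₂.hom_surjective t₂
  obtain ⟨t, ht⟩ := P₃.hom_surjective t₃
  simp only [MonoidHom.comp_apply, MonoidHom.coe_fst, MonoidHom.coe_snd,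
    Subgroup.coe_subtype] at hi₁₂ hi₁₃ hi₂₁ hi₂₃ hi₃₁ hi₃₂ hθ₁ hθ₂ hθ₃
  obtain ⟨D, hD⟩ : ∃ D : CoverData X₁ X₂ X₃ Y, D = {
      i₁₂ := i₁₂, i₁₃ := i₁₃, i₂₁ := i₂₁, i₂₃ := i₂₃, i₃₁ := i₃₁, i₃₂ := i₃₂
      h₁ := (φ.comp inFst).comp P₁.hom
      h₂ := (φ.comp inSnd).comp P₂.hom
      h₃ := (φ.comp inThd).comp P₃.hom
      θ₁ := θ₁, θ₂ := θ₂, θ₃ := θ₃, s := s, t := t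
      h₃_t := by simp [ht, J.map_t₃]
      h_θ := fun w => by
        simp only [MonoidHom.comp_apply, hθ₁, hθ₂, hθ₃, inFst_apply, inSnd_apply, inThd_apply]
        rw [← map_eq_mul_three]
        exact (π w).2 } := ⟨_, rfl⟩
  have hnf : ∀ w, π (D.nf w) = π w := by
    intro w
    have h3 := D.h₃_third w
    have hth : P₃.hom (D.third w) = t₃ ^ D.height w * (π w : G₁ × G₂ × G₃).2.2 := by
      rw [CoverData.third, _root_.map_mul, map_zpow]
      simp only [hD, ht, hθ₃]
    have hh : D.height w = (φ ((π w : G₁ × G₂ × G₃).1, 1, 1)).toAdd +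
        (φ (1, (π w : G₁ × G₂ × G₃).2.1, 1)).toAdd := by
      simp [CoverData.height, hD, hθ₁, hθ₂]
    have h3' : φ (1, 1, P₃.hom (D.third w)) = 1 := by
      have e : D.h₃ (D.third w) = φ (1, 1, P₃.hom (D.third w)) := by
        simp [hD]
      rw [← e]; exact h3
    have e1 : π (D.nf w) = J.J₁₃ (P₁.hom (θ₁ w)) * J.J₂₃ (P₂.hom (θ₂ w)) *
        J.J₃₁ (P₃.hom (D.third w)) := by
      rw [← hi₁₃, ← hi₂₃, ← hi₃₁, ← _root_.map_mul, ← _root_.map_mul, CoverData.nf]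
      simp only [hD]
    rw [e1]
    -- In the first coordinate, `J₃₁` contributes no power of `t₁` by `h3'`; in the third, `t₃ ^
    -- height` cancels the corrections made by `J₁₃` and `J₂₃`.
    ext
    · simp [J.coe_J₁₃, J.coe_J₂₃, J.coe_J₃₁, h3', hθ₁]
    · simp [J.coe_J₁₃, J.coe_J₂₃, J.coe_J₃₁, hθ₂]
    · simp only [Subgroup.coe_mul, J.coe_J₁₃, J.coe_J₂₃, J.coe_J₃₁, Prod.snd_mul, hth, hh, hθ₁, hθ₂]
      group
  have hrels : ∀ r ∈ D.rels, π r = 1 := by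
    intro r hr
    rcases hr with ((((((hr | hr) | hr) | hr) | hr) | hr) | ⟨y, rfl⟩) | ⟨y, rfl⟩
    · refine map_eq_one_of_mem_commRels (fun u v => ?_) hr
      simp only [hD, hi₁₃, hi₂₃]
      ext <;> simp only [Subgroup.coe_mul, J.coe_J₁₃, J.coe_J₂₃, Prod.fst_mul, Prod.snd_mul] <;>
        group
    · refine map_eq_one_of_mem_commRels (fun u v => ?_) hr
      simp only [hD, hi₁₂, hi₃₂]
      ext <;> simp only [Subgroup.coe_mul, J.coe_J₁₂, J.coe_J₃₂, Prod.fst_mul, Prod.snd_mul] <;>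
        group
    · refine map_eq_one_of_mem_commRels (fun u v => ?_) hr
      simp only [hD, hi₂₁, hi₃₁]
      ext <;> simp only [Subgroup.coe_mul, J.coe_J₂₁, J.coe_J₃₁, Prod.fst_mul, Prod.snd_mul] <;>
        group
    · refine map_eq_one_of_mem_twistRels (fun u => ?_) (fun u => ?_) hr <;>
      simp only [hD, hi₁₃, hi₁₂, hi₃₂, ht, _root_.map_inv] <;> ext <;>
      simp [J.coe_J₁₂, J.coe_J₁₃, J.coe_J₃₂, J.map_t₃]
      group
    · refine map_eq_one_of_mem_twistRels (fun u => ?_) (fun u => ?_) hr <;>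
      simp only [hD, hi₂₃, hi₂₁, hi₃₁, ht, _root_.map_inv] <;> ext <;>
      simp [J.coe_J₂₁, J.coe_J₂₃, J.coe_J₃₁, J.map_t₃]
      group
    · refine map_eq_one_of_mem_twistRels (fun u => ?_) (fun u => ?_) hr <;>
      simp only [hD, hi₃₂, hi₂₁, hi₃₁, hs, _root_.map_inv] <;> ext <;>
      simp [J.coe_J₂₁, J.coe_J₃₂, J.coe_J₃₁, J.map_t₂]
      group
    · simp [hnf]
    · simp only [_root_.map_mul, _root_.map_inv, hnf, mul_inv_cancel]
  obtain ⟨C, hC⟩ := D.closeIn_nf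
  obtain ⟨L, hL⟩ := D.exists_bounds
  -- `D.rels` brings `w` to normal form; the images of the relators of the factors then fill its
  -- three pieces, each null-homotopic in its own factor.
  refine ⟨D.rels ∪ D.i₁₃ '' P₁.rels ∪ D.i₂₃ '' P₂.rels ∪ D.i₃₁ '' P₃.rels,
    ((D.finite_rels.union (P₁.finite_rels.image _)).union (P₂.finite_rels.image _)).union
      (P₃.finite_rels.image _), ?_, C + L, fun n w hn hw => ?_⟩
  · rintro r (((hr | ⟨r, hr, rfl⟩) | ⟨r, hr, rfl⟩) | ⟨r, hr, rfl⟩)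
    · exact hrels r hr
    · simp only [hD, hi₁₃, P₁.hom_eq_one_of_mem hr, _root_.map_one]
    · simp only [hD, hi₂₃, P₂.hom_eq_one_of_mem hr, _root_.map_one]
    · simp only [hD, hi₃₁, P₃.hom_eq_one_of_mem hr, _root_.map_one]
  · obtain ⟨l1, l2, l3, -⟩ := hL w
    have hLn : L * norm w ≤ (C + L) * n := Nat.mul_le_mul (by omega) hn
    have w1 : P₁.hom (D.θ₁ w) = 1 := by simp [hD, hθ₁, hw]
    have w2 : P₂.hom (D.θ₂ w) = 1 := by simp [hD, hθ₂, hw]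
    have w3 : P₃.hom (D.third w) = 1 := by
      have e1 : P₃.hom (D.θ₃ w) = 1 := by simp [hD, hθ₃, hw]
      have e2 : D.height w = 0 := by simp [CoverData.height, hD, hθ₁, hθ₂, hw, ← Prod.one_eq_mk]
      rw [CoverData.third, e2, zpow_zero, one_mul, e1]
    have f0 := (hC w).mono (Nat.mul_le_mul_left C (Nat.pow_le_pow_left hn 2))
    have f1 := (P₁.fillsIn_dehn w1 (l1.trans hLn)).map D.i₁₃ (c := 1)
      (T := D.rels ∪ D.i₁₃ '' P₁.rels ∪ D.i₂₃ '' P₂.rels ∪ D.i₃₁ '' P₃.rels)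
      fun r hr => FillsIn.of_mem (.inl (.inl (.inr ⟨r, hr, rfl⟩)))
    have f2 := (P₂.fillsIn_dehn w2 (l2.trans hLn)).map D.i₂₃ (c := 1)
      (T := D.rels ∪ D.i₁₃ '' P₁.rels ∪ D.i₂₃ '' P₂.rels ∪ D.i₃₁ '' P₃.rels)
      fun r hr => FillsIn.of_mem (.inl (.inr ⟨r, hr, rfl⟩))
    have f3 := (P₃.fillsIn_dehn w3 (l3.trans hLn)).map D.i₃₁ (c := 1)
      (T := D.rels ∪ D.i₁₃ '' P₁.rels ∪ D.i₂₃ '' P₂.rels ∪ D.i₃₁ '' P₃.rels)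
      fun r hr => FillsIn.of_mem (.inr ⟨r, hr, rfl⟩)
    have f4 := (FillsIn.mono_set f0 (T := D.rels ∪ D.i₁₃ '' P₁.rels ∪ D.i₂₃ '' P₂.rels ∪
      D.i₃₁ '' P₃.rels) (fun r hr => .inl (.inl (.inl hr)))).mul ((f1.mul f2).mul f3)
    rw [← CoverData.nf, inv_mul_cancel_right] at f4
    refine f4.mono ?_
    have := Nat.mul_le_mul_right (n ^ 2) (Nat.le_add_right C L)
    omega

end Kernel

/-! ### Comparison of functions up to linear rescaling -/

/-- `f n ≤ C * g (C * n)` for some constant `C`. -/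
def LinearlyLE (f g : ℕ → ℕ) : Prop := ∃ C : ℕ, ∀ n, f n ≤ C * g (C * n)

namespace LinearlyLE

variable {f f' g h : ℕ → ℕ}

theorem trans (hfg : LinearlyLE f g) (hgh : LinearlyLE g h) : LinearlyLE f h := by
  obtain ⟨C, hC⟩ := hfg
  obtain ⟨D, hD⟩ := hgh
  refine ⟨C * D, fun n => (hC n).trans ?_⟩
  have := Nat.mul_le_mul_left C (hD (C * n))
  rw [← mul_assoc, ← mul_assoc, mul_comm D C] at this
  exact this

theorem add (hg : Monotone g) (hf : LinearlyLE f g) (hf' : LinearlyLE f' g) :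
    LinearlyLE (fun n => f n + f' n) g := by
  obtain ⟨C, hC⟩ := hf
  obtain ⟨D, hD⟩ := hf'
  refine ⟨C + D, fun n => ?_⟩
  rw [add_mul C D (g _)]
  exact add_le_add ((hC n).trans (Nat.mul_le_mul_left _ (hg (by gcongr; omega))))
    ((hD n).trans (Nat.mul_le_mul_left _ (hg (by gcongr; omega))))

theorem of_le (hff' : ∀ n, f n ≤ f' n) (h : LinearlyLE f' g) : LinearlyLE f g := by
  obtain ⟨C, hC⟩ := h
  exact ⟨C, fun n => (hff' n).trans (hC n)⟩

end LinearlyLE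

theorem linearlyLE_mul_comp {f : ℕ → ℕ} (hf : Monotone f) (k l : ℕ) :
    LinearlyLE (fun n => k * f (l * n)) f :=
  ⟨k + l, fun n => Nat.mul_le_mul (Nat.le_add_right k l)
    (hf (Nat.mul_le_mul_right n (Nat.le_add_left l k)))⟩

theorem linearlyLE_comp {f : ℕ → ℕ} (hf : Monotone f) (k : ℕ) :
    LinearlyLE (fun n => f (k * n)) f :=
  ⟨k + 1, fun n => (hf (Nat.mul_le_mul_right n (Nat.le_succ k))).trans
    (Nat.le_mul_of_pos_left _ (Nat.succ_pos k))⟩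

theorem linearlyLE_mul_sq {g : ℕ → ℕ} (hg : LinearlyLE (fun n => n ^ 2) g) (k : ℕ) :
    LinearlyLE (fun n => k * n ^ 2) g :=
  LinearlyLE.trans ⟨k + 1, fun _ => Nat.mul_le_mul (Nat.le_succ k)
    (Nat.pow_le_pow_left (Nat.le_mul_of_pos_left _ (Nat.succ_pos k)) 2)⟩ hg

theorem FinitePresentation.linearlyLE_of_retract {X G Z H : Type*} [Group G] [Group H]
    (P : FinitePresentation X G) (Q : FinitePresentation Z H) (i : G →* H)
    (r : H →* G) (hri : ∀ g, r (i g) = g) (hQ : LinearlyLE (fun n => n ^ 2) Q.dehn) :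
    LinearlyLE P.dehn Q.dehn := by
  obtain ⟨C, hC⟩ := P.dehn_le_of_retract Q i r hri
  refine LinearlyLE.of_le (f' := fun n => C * Q.dehn (C * n) + C * n ^ 2)
    (fun n => (hC n).trans (Nat.add_le_add_left (Nat.mul_le_mul_left _
      (Nat.le_self_pow two_ne_zero n)) _))
    (LinearlyLE.add Q.dehn_mono ⟨C, fun _ => le_rfl⟩ (linearlyLE_mul_sq hQ C))

theorem LinearlyLE.asympLE {f g : ℕ → ℕ} (hg : Monotone g) (h : LinearlyLE f g) :
    AsympLE (fun n => (f n : ℝ)) (fun n => (g n : ℝ)) := by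
  obtain ⟨C, hC⟩ := h
  refine ⟨C + 1, Nat.succ_pos C, fun n => ?_⟩
  have h1 : f n ≤ (C + 1) * g ((C + 1) * n + (C + 1)) + (C + 1) * n + (C + 1) :=
    (hC n).trans ((Nat.mul_le_mul (Nat.le_succ C) (hg ((Nat.mul_le_mul_right n
      (Nat.le_succ C)).trans (Nat.le_add_right _ _)))).trans
      ((Nat.le_add_right _ _).trans (Nat.le_add_right _ _)))
  beta_reduce
  exact_mod_cast h1

theorem LinearlyLE.asympLE_superadditiveClosure_mul_log {f g : ℕ → ℕ} (hg : Monotone g)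
    (h : LinearlyLE f g) : AsympLE (fun n => (f n : ℝ))
      (fun n => superadditiveClosure (fun k => (g k : ℝ)) n * Real.log n) := by
  obtain ⟨C, hC⟩ := h
  -- Adding 3 keeps the argument `N` at least `3 > e`, even for `n = 0`, so `log N ≥ 1`. The
  -- logarithm and the closure then only enlarge the bound.
  refine ⟨C + 3, Nat.succ_pos _, fun n => ?_⟩
  obtain ⟨N, hN⟩ : ∃ N, N = (C + 3) * n + (C + 3) := ⟨_, rfl⟩
  simp only [← hN]
  have h1 : f n ≤ (C + 3) * g N := (hC n).trans (Nat.mul_le_mul (by omega) (hg (by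
    rw [hN]; exact (Nat.mul_le_mul_right n (by omega)).trans (Nat.le_add_right _ _))))
  have h1' : (f n : ℝ) ≤ ((C + 3 : ℕ) : ℝ) * g N := by exact_mod_cast h1
  have h2 : (g N : ℝ) ≤ superadditiveClosure (fun k => (g k : ℝ)) N :=
    (isLeast_superadditiveClosure fun k => (g k : ℝ)).1.2 N
  have h3 : (1 : ℝ) ≤ Real.log N := by
    have h4 : (3 : ℝ) ≤ N := by
      have : 3 ≤ N := by rw [hN]; omega
      exact_mod_cast this
    rw [Real.le_log_iff_exp_le (by linarith)]
    linarith [Real.exp_one_lt_d9]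
  have h5 : (g N : ℝ) ≤ superadditiveClosure (fun k => (g k : ℝ)) N * Real.log N :=
    h2.trans (le_mul_of_one_le_right ((Nat.cast_nonneg _).trans h2) h3)
  have h6 : (0 : ℝ) ≤ ((C + 3 : ℕ) : ℝ) * n + ((C + 3 : ℕ) : ℝ) := by positivity
  linarith [mul_le_mul_of_nonneg_left h5 (Nat.cast_nonneg (α := ℝ) (C + 3))]

/-! ### Finite presentation of the kernel and comparison of Dehn functions -/

section Kernel

variable {G₁ G₂ G₃ : Type*} [Group G₁] [Group G₂] [Group G₃] {φ : G₁ × G₂ × G₃ →* Multiplicative ℤ}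
  {t₁ : G₁} {t₂ : G₂} {t₃ : G₃}

/-- The group version of the normal form: a power of `t₃` in the last argument cancels those from
`J₁₃` and `J₂₃`, and makes its height zero. -/
theorem KerHoms.eq_mul_three (J : KerHoms φ t₁ t₂ t₃) (k : φ.ker) :
    ∃ a b c, k = J.J₁₃ a * J.J₂₃ b * J.J₃₁ c := by
  obtain ⟨⟨a, b, c⟩, hk⟩ := k
  have hk' : φ (a, 1, 1) * φ (1, b, 1) * φ (1, 1, c) = 1 := by
    rw [← map_eq_mul_three]; exact hk
  refine ⟨a, b, t₃ ^ (φ (a, 1, 1) * φ (1, b, 1)).toAdd * c, ?_⟩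
  have h1 : φ (1, 1, t₃ ^ (φ (a, 1, 1) * φ (1, b, 1)).toAdd * c) = 1 := by
    have e : ((1, 1, t₃ ^ (φ (a, 1, 1) * φ (1, b, 1)).toAdd * c) : G₁ × G₂ × G₃) =
      (1, 1, t₃ ^ (φ (a, 1, 1) * φ (1, b, 1)).toAdd) * (1, 1, c) := by simp
    rw [e, map_mul, map_zpow_thd φ J.map_t₃, hk']
  ext
  · simp only [Subgroup.coe_mul, J.coe_J₁₃, J.coe_J₂₃, J.coe_J₃₁, Prod.fst_mul, h1]
    simp
  · simp [J.coe_J₁₃, J.coe_J₂₃, J.coe_J₃₁]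
  · simp only [Subgroup.coe_mul, J.coe_J₁₃, J.coe_J₂₃, J.coe_J₃₁, Prod.snd_mul, toAdd_mul]
    group

open Classical in
theorem KerHoms.isFinitelyPresented_ker (J : KerHoms φ t₁ t₂ t₃) {X₁ X₂ X₃ : Type*}
    (P₁ : FinitePresentation X₁ G₁) (P₂ : FinitePresentation X₂ G₂)
    (P₃ : FinitePresentation X₃ G₃) : Group.IsFinitelyPresented φ.ker := by
  have := P₁.finite_gens
  have := P₂.finite_gens
  have := P₃.finite_gens
  obtain ⟨π, hπ⟩ : ∃ π : FreeGroup (X₁ ⊕ X₂ ⊕ X₃) →* φ.ker, π = FreeGroup.lift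
    (Sum.elim (fun x => J.J₁₃ (P₁.hom (FreeGroup.of x)))
      (Sum.elim (fun x => J.J₂₃ (P₂.hom (FreeGroup.of x)))
        (fun x => J.J₃₁ (P₃.hom (FreeGroup.of x))))) := ⟨_, rfl⟩
  have h₁ : π.comp (FreeGroup.map Sum.inl) = J.J₁₃.comp P₁.hom := by ext x <;> simp [hπ]
  have h₂ : π.comp (FreeGroup.map (Sum.inr ∘ Sum.inl)) = J.J₂₃.comp P₂.hom := by
    ext x <;> simp [hπ]
  have h₃ : π.comp (FreeGroup.map (Sum.inr ∘ Sum.inr)) = J.J₃₁.comp P₃.hom := by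
    ext x <;> simp [hπ]
  have hsurj : Function.Surjective π := by
    intro k
    obtain ⟨a, b, c, rfl⟩ := J.eq_mul_three k
    obtain ⟨u, rfl⟩ := P₁.hom_surjective a
    obtain ⟨v, rfl⟩ := P₂.hom_surjective b
    obtain ⟨w, rfl⟩ := P₃.hom_surjective c
    refine ⟨FreeGroup.map Sum.inl u * FreeGroup.map (Sum.inr ∘ Sum.inl) v *
      FreeGroup.map (Sum.inr ∘ Sum.inr) w, ?_⟩
    rw [map_mul, map_mul]
    exact congrArg₂ _ (congrArg₂ _ (DFunLike.congr_fun h₁ u) (DFunLike.congr_fun h₂ v))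
      (DFunLike.congr_fun h₃ w)
  -- This needs only a finite generating set of the kernel; a filling of every null-homotopic word
  -- shows that `S` normally generates the relations.
  obtain ⟨S, hS, hS1, C, hC⟩ := J.exists_relators P₁ P₂ P₃ π hsurj
  refine Group.isFinitelyPresented_of_ker π hsurj hS (le_antisymm (fun w hw => ?_) ?_)
  · exact (hC _ w le_rfl hw).mem_normalClosure
  · exact Subgroup.normalClosure_le_normal hS1

open Classical in
theorem KerHoms.dehn_linearlyLE (J : KerHoms φ t₁ t₂ t₃) {X₁ X₂ X₃ Y : Type*}
    (P₁ : FinitePresentation X₁ G₁) (P₂ : FinitePresentation X₂ G₂)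
    (P₃ : FinitePresentation X₃ G₃) (Q : FinitePresentation Y φ.ker) {g : ℕ → ℕ} (hg : Monotone g)
    (hsq : LinearlyLE (fun n => n ^ 2) g) (h₁ : LinearlyLE P₁.dehn g)
    (h₂ : LinearlyLE P₂.dehn g) (h₃ : LinearlyLE P₃.dehn g) : LinearlyLE Q.dehn g := by
  have := Q.finite_gens
  obtain ⟨S, hS, hS1, C, hC⟩ := J.exists_relators P₁ P₂ P₃ Q.hom Q.hom_surjective
  obtain ⟨M, hM⟩ := Q.exists_fillsIn hS hS1
  have key : ∀ n, Q.dehn n ≤ M * (C * n ^ 2 +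
      (P₁.dehn (C * n) + P₂.dehn (C * n) + P₃.dehn (C * n))) := fun n =>
    Q.dehn_le fun w hn hw => (hC n w hn hw).map (MonoidHom.id _) hM
  have h : LinearlyLE (fun n => C * n ^ 2 +
      (P₁.dehn (C * n) + P₂.dehn (C * n) + P₃.dehn (C * n))) g :=
    (linearlyLE_mul_sq hsq C).add hg
      ((((linearlyLE_comp P₁.dehn_mono C).trans h₁).add hg
        ((linearlyLE_comp P₂.dehn_mono C).trans h₂)).add hg
        ((linearlyLE_comp P₃.dehn_mono C).trans h₃))
  obtain ⟨D, hD⟩ := h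
  refine ⟨M * D + D, fun n => (key n).trans ((Nat.mul_le_mul_left M (hD n)).trans ?_)⟩
  rw [← mul_assoc]
  exact Nat.mul_le_mul (Nat.le_add_right _ _) (hg (Nat.mul_le_mul_right n (Nat.le_add_left _ _)))

-- The projections to the coordinates, followed by the inclusions, split a word into three commuting
-- words at quadratic cost, and each is filled in its own factor.
open Classical FreeGroup in
theorem FinitePresentation.dehn_prod_linearlyLE {X X₁ X₂ X₃ : Type*}
    (P : FinitePresentation X (G₁ × G₂ × G₃))
    (P₁ : FinitePresentation X₁ G₁) (P₂ : FinitePresentation X₂ G₂)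
    (P₃ : FinitePresentation X₃ G₃) {g : ℕ → ℕ} (hg : Monotone g)
    (hsq : LinearlyLE (fun n => n ^ 2) g) (h₁ : LinearlyLE P₁.dehn g)
    (h₂ : LinearlyLE P₂.dehn g) (h₃ : LinearlyLE P₃.dehn g) : LinearlyLE P.dehn g := by
  have := P.finite_gens
  obtain ⟨σ₁, hσ₁⟩ := exists_lift P.hom_surjective (inFst.comp P₁.hom)
  obtain ⟨σ₂, hσ₂⟩ := exists_lift P.hom_surjective (inSnd.comp P₂.hom)
  obtain ⟨σ₃, hσ₃⟩ := exists_lift P.hom_surjective (inThd.comp P₃.hom)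
  obtain ⟨θ₁, hθ₁⟩ := exists_lift P₁.hom_surjective ((MonoidHom.fst G₁ (G₂ × G₃)).comp P.hom)
  obtain ⟨θ₂, hθ₂⟩ := exists_lift P₂.hom_surjective
    (((MonoidHom.fst G₂ G₃).comp (MonoidHom.snd G₁ (G₂ × G₃))).comp P.hom)
  obtain ⟨θ₃, hθ₃⟩ := exists_lift P₃.hom_surjective
    (((MonoidHom.snd G₂ G₃).comp (MonoidHom.snd G₁ (G₂ × G₃))).comp P.hom)
  simp only [MonoidHom.comp_apply, MonoidHom.coe_fst, MonoidHom.coe_snd, inFst_apply, inSnd_apply,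
    inThd_apply] at hσ₁ hσ₂ hσ₃ hθ₁ hθ₂ hθ₃
  obtain ⟨M₁, hM₁⟩ := P₁.exists_fillsIn_map P (g := inFst) (f := σ₁) hσ₁
  obtain ⟨M₂, hM₂⟩ := P₂.exists_fillsIn_map P (g := inSnd) (f := σ₂) hσ₂
  obtain ⟨M₃, hM₃⟩ := P₃.exists_fillsIn_map P (g := inThd) (f := σ₃) hσ₃
  obtain ⟨L₁, hL₁⟩ := exists_norm_map_le θ₁
  obtain ⟨L₂, hL₂⟩ := exists_norm_map_le θ₂
  obtain ⟨L₃, hL₃⟩ := exists_norm_map_le θ₃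
  obtain ⟨c, hc⟩ := P.exists_closeIn (f := fun x => of x)
    (g := fun x => σ₁ (θ₁ (of x)) * σ₂ (θ₂ (of x)) * σ₃ (θ₃ (of x)))
    (fun x => by simp [hσ₁, hσ₂, hσ₃, hθ₁, hθ₂, hθ₃])
  obtain ⟨c₁₂, hc₁₂⟩ := P.exists_closeIn (ι := X × X)
    (f := fun p => σ₁ (θ₁ (of p.1)) * σ₂ (θ₂ (of p.2)))
    (g := fun p => σ₂ (θ₂ (of p.2)) * σ₁ (θ₁ (of p.1))) (fun p => by simp [hσ₁, hσ₂])
  obtain ⟨c₁₃, hc₁₃⟩ := P.exists_closeIn (ι := X × X)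
    (f := fun p => σ₁ (θ₁ (of p.1)) * σ₃ (θ₃ (of p.2)))
    (g := fun p => σ₃ (θ₃ (of p.2)) * σ₁ (θ₁ (of p.1))) (fun p => by simp [hσ₁, hσ₃])
  obtain ⟨c₂₃, hc₂₃⟩ := P.exists_closeIn (ι := X × X)
    (f := fun p => σ₂ (θ₂ (of p.1)) * σ₃ (θ₃ (of p.2)))
    (g := fun p => σ₃ (θ₃ (of p.2)) * σ₂ (θ₂ (of p.1))) (fun p => by simp [hσ₂, hσ₃])
  obtain ⟨m, hm⟩ : ∃ m, m = c + c₁₂ + c₁₃ + c₂₃ := ⟨_, rfl⟩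
  have hk : ∀ w : FreeGroup X, CloseIn P.rels (4 * m * norm w ^ 2) w
      (σ₁ (θ₁ w) * σ₂ (θ₂ w) * σ₃ (θ₃ w)) := fun w =>
    CloseIn.hom_prod_three (k := MonoidHom.id _) (f₁ := σ₁.comp θ₁) (f₂ := σ₂.comp θ₂)
      (f₃ := σ₃.comp θ₃) (fun x => (hc x).mono (by omega))
      (fun x y => (hc₁₂ (x, y)).mono (by omega)) (fun x y => (hc₁₃ (x, y)).mono (by omega))
      (fun x y => (hc₂₃ (x, y)).mono (by omega)) w
  refine LinearlyLE.of_le (f' := fun n => 4 * m * n ^ 2 + (M₁ * P₁.dehn (L₁ * n) +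
    M₂ * P₂.dehn (L₂ * n) + M₃ * P₃.dehn (L₃ * n))) (fun n => P.dehn_le fun w hn hw => ?_)
    ((linearlyLE_mul_sq hsq _).add hg
      ((((linearlyLE_mul_comp P₁.dehn_mono _ _).trans h₁).add hg
        ((linearlyLE_mul_comp P₂.dehn_mono _ _).trans h₂)).add hg
        ((linearlyLE_mul_comp P₃.dehn_mono _ _).trans h₃)))
  have e1 := hM₁ _ _ (P₁.fillsIn_dehn (w := θ₁ w) (by rw [hθ₁, hw]; rfl)
    ((hL₁ w).trans (Nat.mul_le_mul_left _ hn)))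
  have e2 := hM₂ _ _ (P₂.fillsIn_dehn (w := θ₂ w) (by rw [hθ₂, hw]; rfl)
    ((hL₂ w).trans (Nat.mul_le_mul_left _ hn)))
  have e3 := hM₃ _ _ (P₃.fillsIn_dehn (w := θ₃ w) (by rw [hθ₃, hw]; rfl)
    ((hL₃ w).trans (Nat.mul_le_mul_left _ hn)))
  have e4 := FillsIn.mul ((hk w).mono (Nat.mul_le_mul_left _ (Nat.pow_le_pow_left hn 2)))
    ((e1.mul e2).mul e3)
  rwa [inv_mul_cancel_right] at e4

theorem KerHoms.sq_linearlyLE_dehn_prod (J : KerHoms φ t₁ t₂ t₃) {X : Type*}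
    (P : FinitePresentation X (G₁ × G₂ × G₃)) : LinearlyLE (fun n => n ^ 2) P.dehn :=
  P.sq_le_dehn ((φ.comp inFst).comp (MonoidHom.fst _ _))
    ((φ.comp inSnd).comp ((MonoidHom.fst _ _).comp (MonoidHom.snd _ _))) (t₁, 1, 1) (1, t₂, 1)
    (by ext <;> simp) (by simp [J.map_t₁]) (by simp [← Prod.one_eq_mk])
    (by simp [← Prod.one_eq_mk]) (by simp [J.map_t₂])

/-- The commuting elements `(t₁, t₂⁻¹, 1)` and `(1, t₂, t₃⁻¹)` are detected by the height of the
first coordinate and minus that of the third. -/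
theorem KerHoms.sq_linearlyLE_dehn_ker (J : KerHoms φ t₁ t₂ t₃) {Y : Type*}
    (Q : FinitePresentation Y φ.ker) : LinearlyLE (fun n => n ^ 2) Q.dehn :=
  Q.sq_le_dehn (((φ.comp inFst).comp (MonoidHom.fst _ _)).comp φ.ker.subtype)
    (((φ.comp inThd).comp ((MonoidHom.snd _ _).comp (MonoidHom.snd _ _))).comp φ.ker.subtype)⁻¹
    (J.J₁₂ t₁) (J.J₂₃ t₂)
    (by ext <;> simp [J.coe_J₁₂, J.coe_J₂₃, J.map_t₁])
    (by simp [J.coe_J₁₂, J.map_t₁]) (by simp [J.coe_J₂₃, ← Prod.one_eq_mk])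
    (by simp [J.coe_J₁₂, ← Prod.one_eq_mk])
    (by
      have := map_zpow_thd φ J.map_t₃ (Multiplicative.ofAdd (-1))
      rw [toAdd_ofAdd] at this
      simp only [MonoidHom.inv_apply, MonoidHom.comp_apply, MonoidHom.coe_snd, inThd_apply,
        Subgroup.coe_subtype, J.coe_J₂₃, J.map_t₂, toAdd_ofAdd, this]
      rfl)

end Kernel

theorem mainTheorem7 {G₁ G₂ G₃ : Type*} [Group G₁] [Group G₂] [Group G₃]
    (hG₁ : Group.IsFinitelyPresented G₁) (hG₂ : Group.IsFinitelyPresented G₂)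
    (hG₃ : Group.IsFinitelyPresented G₃)
    (φ : G₁ × G₂ × G₃ →* Multiplicative ℤ)
    (hφ₁ : Function.Surjective fun g : G₁ => φ (g, 1, 1))
    (hφ₂ : Function.Surjective fun g : G₂ => φ (1, g, 1))
    (hφ₃ : Function.Surjective fun g : G₃ => φ (1, 1, g)) :
    Group.IsFinitelyPresented φ.ker ∧
    ∀ (X Y : Type*) (P : FinitePresentation X (G₁ × G₂ × G₃)) (Q : FinitePresentation Y φ.ker),
      AsympLE (fun n => (P.dehn n : ℝ)) (fun n => (Q.dehn n : ℝ)) ∧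
      AsympLE (fun n => (Q.dehn n : ℝ))
        (fun n => superadditiveClosure (fun k => (P.dehn k : ℝ)) n * Real.log n) := by
  obtain ⟨n₁, ⟨P₁⟩⟩ := hG₁.exists_finitePresentation
  obtain ⟨n₂, ⟨P₂⟩⟩ := hG₂.exists_finitePresentation
  obtain ⟨n₃, ⟨P₃⟩⟩ := hG₃.exists_finitePresentation
  obtain ⟨t₁, t₂, t₃, ⟨J⟩⟩ := exists_kerHoms φ hφ₁ hφ₂ hφ₃
  refine ⟨J.isFinitelyPresented_ker P₁ P₂ P₃, fun X Y P Q => ?_⟩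
  have hP := J.sq_linearlyLE_dehn_prod P
  have hQ := J.sq_linearlyLE_dehn_ker Q
  constructor
  -- Each `Gᵢ` embeds in the kernel by some `Jᵢₖ`, and the projection to the `i`-th coordinate is a
  -- retraction.
  · refine (P.dehn_prod_linearlyLE P₁ P₂ P₃ Q.dehn_mono hQ ?_ ?_ ?_).asympLE Q.dehn_mono
    · exact P₁.linearlyLE_of_retract Q J.J₁₂ ((MonoidHom.fst _ _).comp φ.ker.subtype)
        (fun g => by simp [J.coe_J₁₂]) hQ
    · exact P₂.linearlyLE_of_retract Q J.J₂₁
        (((MonoidHom.fst _ _).comp (MonoidHom.snd _ _)).comp φ.ker.subtype)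
        (fun g => by simp [J.coe_J₂₁]) hQ
    · exact P₃.linearlyLE_of_retract Q J.J₃₁
        (((MonoidHom.snd _ _).comp (MonoidHom.snd _ _)).comp φ.ker.subtype)
        (fun g => by simp [J.coe_J₃₁]) hQ
  · refine (J.dehn_linearlyLE P₁ P₂ P₃ Q P.dehn_mono hP ?_ ?_ ?_).asympLE_superadditiveClosure_mul_log
      P.dehn_mono
    · exact P₁.linearlyLE_of_retract P inFst (MonoidHom.fst _ _) (fun g => rfl) hP
    · exact P₂.linearlyLE_of_retract P inSnd
        ((MonoidHom.fst _ _).comp (MonoidHom.snd _ _)) (fun g => rfl) hP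
    · exact P₃.linearlyLE_of_retract P inThd
        ((MonoidHom.snd _ _).comp (MonoidHom.snd _ _)) (fun g => rfl) hP
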